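/- Let $\mathcal S=\{(-1,0),(0,1),(1,-1)\}$ (the steps W, N, SE). Consider walks that start at $(0,0)$, take their steps in $\mathcal S$ and visit only points with non-negative coordinates. Let $q(i,j;n)$ be the number of such walks of length $n$ ending at $(i,j)$, and let $Q(x,y;t)=\sum_{i,j,n\ge 0} q(i,j;n)\,x^iy^jt^n$. Write $\bar x=1/x$ and $\bar y=1/y$. (1) $Q(x,y;t)$ is the non-negative part in $x$ and $y$ of a rational series in $t$ with coefficients in $\mathbb Q[x,\bar x,y,\bar y]$: $$Q(x,y;t)=[x^{\ge}y^{\ge}]\,\frac{(1-\bar x\bar y)(1-\bar x^2y)(1-x\bar y^2)}{1-t(\bar x+y+x\bar y)},$$ where the fraction is expanded in powers of $t$ and $[x^{\ge}y^{\ge}]$ keeps the monomials $x^ay^bt^n$ with $a,b\ge 0$. Moreover $Q(x,y;t)$ is D-finite: its partial derivatives of all orders in $x,y,t$ span a finite-dimensional vector space over $\mathbb Q(x,y,t)$. (2) For all integers $i,j,m\ge 0$, the number of walks of length $n=3m+2i+j$ ending at $(i,j)$ is $$q(i,j;n)=\frac{(i+1)(j+1)(i+j+2)\,(3m+2i+j)!}{m!\,(m+i+1)!\,(m+i+j+2)!}.$$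 In particular, for $m\ge 0$, $$q(0,0;3m)=\frac{2\,(3m)!}{m!\,(m+1)!\,(m+2)!},\qquad q(0,0;3m)\sim\sqrt3\,\frac{3^{3m}}{\pi m^4}\quad(m\to\infty).$$ The series $Q(0,0;t)$ is transcendental over $\mathbb Q(t)$, and $Q(x,y;t)$ is transcendental over $\mathbb Q(x,y,t)$. (3) The series $Q(x,1/x;t)$ is algebraic of degree $2$ over $\mathbb Q(x,t)$: $$Q(x,1/x;t)=\frac{1-t\bar x-\sqrt{1-2\bar xt+t^2\bar x^2-4t^2x}}{2xt^2},$$ where the square root is the power series in $t$ with constant term $1$. (4) The total number of such walks of length $n$ is the $n$-th Motzkin number $M_n$ (defined by $M_0=1$ and $M_{n+1}=M_n+\sum_{k=0}^{n-1}M_kM_{n-1-k}$), and $$Q(1,1;t)=\frac{1-t-\sqrt{(1+t)(1-3t)}}{2t^2}=\sum_{n\ge 0}t^n\sum_{k=0}^{\lfloor n/2\rfloor}\frac1{k+1}\binom n{2k}\binom{2k}k .$$ -/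

import Mathlib

open scoped RatFunc

noncomputable section

/-! ### Walks in the quarter plane -/

/-- The step set `{W, N, SE}`. -/
def tandemSteps : Finset (ℤ × ℤ) := {(-1, 0), (0, 1), (1, -1)}

/-- The position after `k` steps of the walk that starts at the origin and whose successive
steps are `w 0, …, w (n - 1)`. -/
def walkPos {n : ℕ} (w : Fin n → ℤ × ℤ) (k : ℕ) : ℤ × ℤ :=
  ∑ i ∈ Finset.univ.filter (fun i : Fin n => (i : ℕ) < k), w i

/-- The `n`-step walks with steps in `S` that start at the origin and visit only points with
non-negative coordinates. -/
def quadrantWalks (S : Finset (ℤ × ℤ)) (n : ℕ) : Finset (Fin n → ℤ × ℤ) :=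
  (Fintype.piFinset fun _ : Fin n => S).filter fun w : Fin n → ℤ × ℤ =>
    ∀ k : Fin (n + 1), 0 ≤ (walkPos w k).1 ∧ 0 ≤ (walkPos w k).2

/-- `q(i,j;n)`: the number of `n`-step quarter plane walks that end at `(i,j)`. -/
def walkCount (S : Finset (ℤ × ℤ)) (i j n : ℕ) : ℕ :=
  ((quadrantWalks S n).filter fun w => walkPos w n = ((i : ℤ), (j : ℤ))).card

/-- `Q(x,y;t)`, as a power series in `t` with coefficients in `ℚ[x,y]`
(`x` is the variable `0` and `y` the variable `1`). The endpoint of a quarter plane walk has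
non-negative coordinates, so `Int.toNat` loses nothing. -/
def walkSeries (S : Finset (ℤ × ℤ)) : PowerSeries (MvPolynomial (Fin 2) ℚ) :=
  PowerSeries.mk fun n => ∑ w ∈ quadrantWalks S n,
    MvPolynomial.X 0 ^ (walkPos w n).1.toNat * MvPolynomial.X 1 ^ (walkPos w n).2.toNat

/-- The specialization `F(u,v;t)` of `F(x,y;t)`, a power series in `t` with coefficients in
the ring of `u` and `v`. -/
def specialize {A : Type*} [CommRing A] [Algebra ℚ A] (u v : A)
    (F : PowerSeries (MvPolynomial (Fin 2) ℚ)) : PowerSeries A :=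
  PowerSeries.map (MvPolynomial.aeval ![u, v] : MvPolynomial (Fin 2) ℚ →ₐ[ℚ] A).toRingHom F

/-- `F(x,y;t)` as a power series in the three variables `x = X 0`, `y = X 1`, `t = X 2`. -/
def toThreeVar (F : PowerSeries (MvPolynomial (Fin 2) ℚ)) : MvPowerSeries (Fin 3) ℚ :=
  fun e => MvPolynomial.coeff (Finsupp.equivFunOnFinite.symm ![e 0, e 1])
    (PowerSeries.coeff (e 2) F)

/-! ### Laurent polynomials in `x`, `y` and non-negative parts -/

/-- The ring `ℚ[x, 1/x, y, 1/y]`. -/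
abbrev LaurentXY : Type := AddMonoidAlgebra ℚ (ℤ × ℤ)

/-- The monomial `x ^ a * y ^ b`. -/
def monoXY (a b : ℤ) : LaurentXY := AddMonoidAlgebra.single (a, b) 1

/-- The part of a Laurent polynomial formed of the monomials `x ^ a * y ^ b` with
`a ≥ 0` and `b ≥ 0`. -/
def nonnegPartXY (f : LaurentXY) : LaurentXY :=
  AddMonoidAlgebra.ofCoeff (f.coeff.filter fun p : ℤ × ℤ => 0 ≤ p.1 ∧ 0 ≤ p.2)

/-- `[x^≥ y^≥] F(x,y;t)` for a power series `F` in `t` with coefficients in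
`ℚ[x, 1/x, y, 1/y]`. -/
def nonnegPart (F : PowerSeries LaurentXY) : PowerSeries LaurentXY :=
  PowerSeries.mk fun n => nonnegPartXY (PowerSeries.coeff n F)

/-- The numerator `(1 - x⁻¹ y⁻¹) (1 - x⁻² y) (1 - x y⁻²)`. -/
def tandemNumerator : LaurentXY :=
  (1 - monoXY (-1) (-1)) * (1 - monoXY (-2) 1) * (1 - monoXY 1 (-2))

/-- The denominator `1 - t (x⁻¹ + y + x y⁻¹)`. -/
def tandemDenominator : PowerSeries LaurentXY :=
  1 - PowerSeries.X * PowerSeries.C (monoXY (-1) 0 + monoXY 0 1 + monoXY 1 (-1))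

/-- The rational series
`(1 - x⁻¹ y⁻¹) (1 - x⁻² y) (1 - x y⁻²) / (1 - t (x⁻¹ + y + x y⁻¹))`, expanded in powers
of `t`. -/
def tandemRational : PowerSeries LaurentXY :=
  PowerSeries.C tandemNumerator * PowerSeries.invOfUnit tandemDenominator 1

/-- `tandemRational` is the quotient of its numerator by its denominator. -/
theorem tandemRational_mul_denominator :
    tandemRational * tandemDenominator = PowerSeries.C tandemNumerator := by
  have h : PowerSeries.constantCoeff tandemDenominator = ((1 : LaurentXYˣ) : LaurentXY) := by
    simp [tandemDenominator]
  rw [tandemRational, mul_assoc, PowerSeries.invOfUnit_mul _ _ h, mul_one]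

/-! ### D-finite series -/

instance mvPowerSeries_isDomain (σ K : Type*) [Field K] : IsDomain (MvPowerSeries σ K) :=
  NoZeroDivisors.to_isDomain _

instance mvPowerSeries_faithful (σ K : Type*) [Field K] :
    FaithfulSMul (MvPolynomial σ K) (FractionRing (MvPowerSeries σ K)) := by
  rw [faithfulSMul_iff_algebraMap_injective,
    IsScalarTower.algebraMap_eq (MvPolynomial σ K) (MvPowerSeries σ K)]
  refine (IsFractionRing.injective (MvPowerSeries σ K) _).comp ?_
  intro a b h
  apply MvPolynomial.coe_injective σ K
  simpa [MvPowerSeries.algebraMap_apply'] using h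

/-- The iterated partial derivative `∂_{i₁} ∂_{i₂} ⋯ ∂_{iᵣ} F` for `l = [i₁, …, iᵣ]`. -/
def iterPDeriv {σ K : Type*} [Field K] (l : List σ) (F : MvPowerSeries σ K) :
    MvPowerSeries σ K :=
  l.foldr (fun i G => MvPowerSeries.pderiv K i G) F

/-- A power series `F` over a field `K` is D-finite if all its partial derivatives (of all
orders) span a finite dimensional vector space over the field of rational functions, inside
the field of fractions of the ring of power series. -/
def IsDFinite {σ K : Type*} [Field K] (F : MvPowerSeries σ K) : Prop :=
  letI : Algebra (FractionRing (MvPolynomial σ K)) (FractionRing (MvPowerSeries σ K)) :=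
    FractionRing.liftAlgebra (MvPolynomial σ K) (FractionRing (MvPowerSeries σ K))
  FiniteDimensional (FractionRing (MvPolynomial σ K))
    (Submodule.span (FractionRing (MvPolynomial σ K))
      (Set.range fun l : List σ =>
        algebraMap (MvPowerSeries σ K) (FractionRing (MvPowerSeries σ K)) (iterPDeriv l F)))

/-! ### Motzkin numbers and square roots -/

/-- The Motzkin numbers `1, 1, 2, 4, 9, 21, …`, defined by the recurrence
`M (n + 1) = M n + ∑_{k < n} M k * M (n - 1 - k)`. -/
def motzkinNumber : ℕ → ℕ
  | 0 => 1
  | n + 1 => motzkinNumber n + ∑ k : Fin n, motzkinNumber k * motzkinNumber (n - 1 - k)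

/-- `s` is the square root of `D` in the ring of power series in `t`, normalized by
`s = 1 + O(t)`. -/
def IsSeriesSqrt {A : Type*} [CommRing A] (s D : PowerSeries A) : Prop :=
  s ^ 2 = D ∧ PowerSeries.constantCoeff s = 1

/-- A power series in `t` over a field `K`, seen in the field `K((t))`. -/
abbrev toLaurent {K : Type*} [Field K] (F : PowerSeries K) : LaurentSeries K :=
  HahnSeries.ofPowerSeries ℤ K F

end

/-! ### The step by step construction of quarter plane walks -/

section Walks

/-! Removing the last step gives a recurrence for $q(i,j;n)$, and almost everything is deduced from
it.

Closed form: a tandem walk is a standard Young tableau with at most three rows, so the hook length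
formula gives $q$; it is checked by induction on $n$ (`walkCount_mul_factorials`).

Non-negative part: the numerator is the signed orbit sum of the monomial $1$ under a group of order
6 generated by two reflections that preserve the step set. The coefficients of the rational series
are therefore antisymmetric and vanish on the lines $a=-1$ and $b=-1$. Inside the quadrant they
satisfy the recurrence of $q$, with the same initial values (`rationalCoeff_eq_walkCount`).

Specializations with $xy=1$: for a walk of length $n$ to $(i,j)$, $n+i-j$ is three times the number
of SE steps. The walks with $k$ such steps number $\binom n{2k}\mathrm{Cat}_k$, as many as Motzkin
paths with $k$ up steps (`tandemCountSE_eq`). Hence $Q(x,1/x;t)$ and $Q(1,1;t)$ are Motzkin series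
and satisfy a quadratic equation (`motzkinSeries_eq`). The degree is exactly 2 because the
discriminant is not a square in $K(t)$.

Transcendence: Stirling's formula gives $q(0,0;3m)\sim c\,27^m/m^4$. Applying $t\,d/dt$ three times
yields coefficients of order $27^m/m$, hence logarithmic growth at $t=1/3$. Algebraic series are
closed under derivation, and none grows like a logarithm (`transcendental_of_log_growth`). For
$Q(x,y;t)$ an algebraic equation is reduced to its part of lowest degree in $x,y$
(`transcendental_of_rowSeries`).

D-finiteness: the functional equation writes $Q$ as a combination of $1$, $Q(x,0;t)$ and $Q(0,y;t)$
over the rational functions. The two axis series have hypergeometric coefficients. Multiply such a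
series termwise by polynomials of degree less than $N$ in the exponents. The coefficient
recurrences, read in top degree, form an invertible linear system, so the span of these products is
finite dimensional and stable under derivations (`derivClosed_termwiseSet`). -/

theorem walkPos_zero {n : ℕ} (w : Fin n → ℤ × ℤ) : walkPos w 0 = 0 := by
  simp [walkPos]

theorem walkPos_snoc_of_le {n : ℕ} (w : Fin n → ℤ × ℤ) (s : ℤ × ℤ) {k : ℕ} (hk : k ≤ n) :
    walkPos (Fin.snoc w s : Fin (n + 1) → ℤ × ℤ) k = walkPos w k := by
  simp only [walkPos, Finset.sum_filter]
  rw [Fin.sum_univ_castSucc]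
  simp [Nat.not_lt.mpr hk]

theorem walkPos_snoc_last {n : ℕ} (w : Fin n → ℤ × ℤ) (s : ℤ × ℤ) :
    walkPos (Fin.snoc w s : Fin (n + 1) → ℤ × ℤ) (n + 1) = walkPos w n + s := by
  simp only [walkPos, Finset.sum_filter]
  rw [Fin.sum_univ_castSucc]
  simp

theorem snoc_mem_quadrantWalks {S : Finset (ℤ × ℤ)} {n : ℕ} {w : Fin n → ℤ × ℤ} {s : ℤ × ℤ} :
    (Fin.snoc w s : Fin (n + 1) → ℤ × ℤ) ∈ quadrantWalks S (n + 1) ↔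
      w ∈ quadrantWalks S n ∧ s ∈ S ∧ 0 ≤ (walkPos w n + s).1 ∧ 0 ≤ (walkPos w n + s).2 := by
  simp only [quadrantWalks, Finset.mem_filter, Fintype.mem_piFinset]
  rw [Fin.forall_fin_succ', Fin.forall_fin_succ' (n := n + 1)]
  have h1 : ∀ k : Fin (n + 1), walkPos (Fin.snoc w s : Fin (n + 1) → ℤ × ℤ) (k : ℕ)
      = walkPos w k := fun k => walkPos_snoc_of_le w s (Nat.lt_succ_iff.mp k.2)
  simp only [Fin.snoc_castSucc, Fin.snoc_last, Fin.val_castSucc, Fin.val_last, h1,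
    walkPos_snoc_last]
  tauto

theorem quadrantWalks_zero (S : Finset (ℤ × ℤ)) : quadrantWalks S 0 = {Fin.elim0} := by
  ext w
  simp only [quadrantWalks, Finset.mem_filter, Fintype.mem_piFinset, Finset.mem_singleton]
  constructor
  · intro _; exact Subsingleton.elim _ _
  · intro _
    exact ⟨fun i => i.elim0, fun k => by simp [walkPos]⟩

theorem sum_quadrantWalks_zero (S : Finset (ℤ × ℤ)) {R : Type*} [AddCommMonoid R]
    (φ : ℤ × ℤ → R) : ∑ w ∈ quadrantWalks S 0, φ (walkPos w 0) = φ 0 := by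
  simp [quadrantWalks_zero, walkPos_zero]

/-- Sums over walks of length `n + 1`, by the last step. -/
theorem sum_quadrantWalks_succ (S : Finset (ℤ × ℤ)) {R : Type*} [AddCommMonoid R] (n : ℕ)
    (φ : ℤ × ℤ → R) :
    ∑ w ∈ quadrantWalks S (n + 1), φ (walkPos w (n + 1)) =
      ∑ w ∈ quadrantWalks S n, ∑ s ∈ S,
        if 0 ≤ (walkPos w n + s).1 ∧ 0 ≤ (walkPos w n + s).2 then φ (walkPos w n + s) else 0 := by
  rw [← Finset.sum_product', ← Finset.sum_filter]
  symm
  refine Finset.sum_bij (fun p _ => (Fin.snoc p.1 p.2 : Fin (n + 1) → ℤ × ℤ)) ?_ ?_ ?_ ?_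
  · rintro ⟨w, s⟩ h
    simp only [Finset.mem_filter, Finset.mem_product] at h
    exact snoc_mem_quadrantWalks.mpr ⟨h.1.1, h.1.2, h.2⟩
  · rintro ⟨w, s⟩ _ ⟨w', s'⟩ _ h
    have := Fin.snoc_injective2 h
    exact Prod.ext this.1 this.2
  · intro w hw
    refine ⟨(Fin.init w, w (Fin.last n)), ?_, Fin.snoc_init_self w⟩
    rw [← Fin.snoc_init_self w, snoc_mem_quadrantWalks] at hw
    simp only [Finset.mem_filter, Finset.mem_product]
    exact ⟨⟨hw.1, hw.2.1⟩, hw.2.2⟩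
  · rintro ⟨w, s⟩ _
    rw [walkPos_snoc_last]

/-- A property of lengths and positions that holds at the start and is kept by each step
holds at the end of each walk. -/
theorem quadrantWalks_end_induction {S : Finset (ℤ × ℤ)} {P : ℕ → ℤ × ℤ → Prop} (h0 : P 0 0)
    (hs : ∀ n p s, s ∈ S → 0 ≤ (p + s).1 → 0 ≤ (p + s).2 → P n p → P (n + 1) (p + s)) :
    ∀ (n : ℕ) (w : Fin n → ℤ × ℤ), w ∈ quadrantWalks S n → P n (walkPos w n) := by
  intro n
  induction n with
  | zero => intro w _; rwa [walkPos_zero]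
  | succ n ih =>
    intro w hw
    rw [← Fin.snoc_init_self w, snoc_mem_quadrantWalks] at hw
    rw [← Fin.snoc_init_self w, walkPos_snoc_last]
    exact hs _ _ _ hw.2.1 hw.2.2.1 hw.2.2.2 (ih _ hw.1)

theorem quadrantWalks_end_nonneg {S : Finset (ℤ × ℤ)} {n : ℕ} {w : Fin n → ℤ × ℤ}
    (hw : w ∈ quadrantWalks S n) : 0 ≤ (walkPos w n).1 ∧ 0 ≤ (walkPos w n).2 :=
  quadrantWalks_end_induction (P := fun _ p => 0 ≤ p.1 ∧ 0 ≤ p.2) (by simp)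
    (fun _ _ _ _ h1 h2 _ => ⟨h1, h2⟩) n w hw

/-- The last step of tandem walks. -/
theorem sum_tandemWalks_succ {R : Type*} [AddCommMonoid R] (n : ℕ) (φ : ℤ × ℤ → R) :
    ∑ w ∈ quadrantWalks tandemSteps (n + 1), φ (walkPos w (n + 1)) =
      ∑ w ∈ quadrantWalks tandemSteps n,
        ((if 0 < (walkPos w n).1 then φ ((walkPos w n).1 - 1, (walkPos w n).2) else 0) +
          (φ ((walkPos w n).1, (walkPos w n).2 + 1) +
          if 0 < (walkPos w n).2 then φ ((walkPos w n).1 + 1, (walkPos w n).2 - 1) else 0)) := by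
  rw [sum_quadrantWalks_succ]
  refine Finset.sum_congr rfl fun w hw => ?_
  obtain ⟨h1, h2⟩ := quadrantWalks_end_nonneg hw
  generalize walkPos w n = p at h1 h2
  obtain ⟨a, b⟩ := p
  simp only at h1 h2
  rw [tandemSteps, Finset.sum_insert (by decide), Finset.sum_insert (by decide),
    Finset.sum_singleton]
  simp only [Prod.mk_add_mk, add_zero]
  congr 1
  · rw [← sub_eq_add_neg]
    exact if_congr (by omega) rfl rfl
  congr 1
  · rw [if_pos (by omega)]
  · rw [← sub_eq_add_neg]
    exact if_congr (by omega) rfl rfl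

theorem sum_quadrantWalks_ite_eq (S : Finset (ℤ × ℤ)) {R : Type*} [Semiring R] (i j n : ℕ) :
    ∑ w ∈ quadrantWalks S n, (if walkPos w n = ((i : ℤ), (j : ℤ)) then (1 : R) else 0) =
      walkCount S i j n := by
  rw [Finset.sum_boole, walkCount]

theorem walkCount_zero (S : Finset (ℤ × ℤ)) (i j : ℕ) :
    walkCount S i j 0 = if i = 0 ∧ j = 0 then 1 else 0 := by
  rw [← Nat.cast_id (walkCount S i j 0), ← sum_quadrantWalks_ite_eq,
    sum_quadrantWalks_zero S fun p => if p = ((i : ℤ), (j : ℤ)) then 1 else 0]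
  refine if_congr ?_ rfl rfl
  simp [Prod.ext_iff, eq_comm]

/-- The last step W, N or SE comes from $(i+1,j)$, $(i,j-1)$ or $(i-1,j+1)$. The guards discard the
predecessors outside the quadrant, so the natural subtractions never truncate. -/
theorem walkCount_succ (i j n : ℕ) :
    walkCount tandemSteps i j (n + 1) =
      walkCount tandemSteps (i + 1) j n +
        ((if 0 < j then walkCount tandemSteps i (j - 1) n else 0) +
          if 0 < i then walkCount tandemSteps (i - 1) (j + 1) n else 0) := by
  rw [← Nat.cast_id (walkCount tandemSteps i j (n + 1)), ← sum_quadrantWalks_ite_eq,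
    sum_tandemWalks_succ n fun p => if p = ((i : ℤ), (j : ℤ)) then 1 else 0]
  rw [Finset.sum_add_distrib, Finset.sum_add_distrib]
  congr 1
  · rw [← Nat.cast_id (walkCount tandemSteps (i + 1) j n), ← sum_quadrantWalks_ite_eq]
    refine Finset.sum_congr rfl fun w hw => ?_
    simp only [Prod.ext_iff]
    split_ifs <;> first | rfl | (exfalso; push_cast at *; omega)
  congr 1
  · split_ifs with hj
    · rw [← Nat.cast_id (walkCount tandemSteps i (j - 1) n), ← sum_quadrantWalks_ite_eq]
      refine Finset.sum_congr rfl fun w hw => ?_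
      simp only [Prod.ext_iff]
      split_ifs <;> first | rfl | (exfalso; omega)
    · refine Finset.sum_eq_zero fun w hw => ?_
      have := quadrantWalks_end_nonneg hw
      rw [if_neg]
      simp only [Prod.ext_iff]
      omega
  · split_ifs with hj
    · rw [← Nat.cast_id (walkCount tandemSteps (i - 1) (j + 1) n), ← sum_quadrantWalks_ite_eq]
      refine Finset.sum_congr rfl fun w hw => ?_
      simp only [Prod.ext_iff]
      split_ifs <;> first | rfl | (exfalso; omega)
    · refine Finset.sum_eq_zero fun w hw => ?_
      have := quadrantWalks_end_nonneg hw
      simp only [Prod.ext_iff]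
      split_ifs <;> first | rfl | (exfalso; omega)

/-- The length of a tandem walk from the origin to `(i, j)` is `3 m + 2 i + j` for some `m ≥ 0`. -/
theorem exists_length_eq {n : ℕ} {w : Fin n → ℤ × ℤ} (hw : w ∈ quadrantWalks tandemSteps n) :
    ∃ m : ℕ, (n : ℤ) = 3 * m + 2 * (walkPos w n).1 + (walkPos w n).2 := by
  refine quadrantWalks_end_induction
    (P := fun n p => ∃ m : ℕ, (n : ℤ) = 3 * m + 2 * p.1 + p.2) ⟨0, by simp⟩ ?_ n w hw
  rintro n ⟨a, b⟩ s hs - - ⟨m, hm⟩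
  simp only [tandemSteps, Finset.mem_insert, Finset.mem_singleton] at hs
  rcases hs with rfl | rfl | rfl
  · exact ⟨m + 1, by simp at *; omega⟩
  · exact ⟨m, by simp at *; omega⟩
  · exact ⟨m, by simp at *; omega⟩

theorem walkCount_eq_zero {i j n : ℕ} (h : ∀ m : ℕ, n ≠ 3 * m + 2 * i + j) :
    walkCount tandemSteps i j n = 0 := by
  rw [walkCount, Finset.card_eq_zero, Finset.filter_eq_empty_iff]
  intro w hw hp
  obtain ⟨m, hm⟩ := exists_length_eq hw
  rw [hp] at hm
  exact h m (by simp at hm; omega)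

/-- The hook length formula for partitions in at most three parts. -/
theorem walkCount_mul_factorials (n : ℕ) : ∀ i j m : ℕ, n = 3 * m + 2 * i + j →
    (walkCount tandemSteps i j n : ℚ) =
      ((i + 1) * (j + 1) * (i + j + 2) * n.factorial : ℚ) /
        (m.factorial * (m + i + 1).factorial * (m + i + j + 2).factorial) := by
  induction n with
  | zero =>
    intro i j m h
    obtain rfl : i = 0 := by omega
    obtain rfl : j = 0 := by omega
    obtain rfl : m = 0 := by omega
    simp [walkCount_zero]
  | succ n ih =>
    intro i j m h
    -- The three predecessors are put over the denominator of the claim. The factors $m$, $j$ and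
    -- $i$ in the numerators make the missing predecessors vanish, and a polynomial identity with
    -- $n+1=3m+2i+j$ remains.
    have e1 : (walkCount tandemSteps (i + 1) j n : ℚ) =
        ((i + 2) * (j + 1) * (i + j + 3) * m * n.factorial : ℚ) /
        (m.factorial * (m + i + 1).factorial * (m + i + j + 2).factorial) := by
      rcases Nat.eq_zero_or_pos m with rfl | hm
      · rw [walkCount_eq_zero (by intro m; omega)]; simp
      · obtain ⟨m, rfl⟩ : ∃ k, m = k + 1 := ⟨m - 1, by omega⟩
        rw [ih (i + 1) j m (by omega)]
        rw [show m + (i + 1) + 1 = m + 1 + i + 1 by ring,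
          show m + (i + 1) + j + 2 = m + 1 + i + j + 2 by ring, Nat.factorial_succ m]
        have := Nat.factorial_ne_zero m
        have := Nat.factorial_ne_zero (m + 1 + i + 1)
        have := Nat.factorial_ne_zero (m + 1 + i + j + 2)
        push_cast
        field_simp
        ring
    have e2 : ((if 0 < j then walkCount tandemSteps i (j - 1) n else 0 : ℕ) : ℚ) =
        ((i + 1) * j * (i + j + 1) * (m + i + j + 2) * n.factorial : ℚ) /
        (m.factorial * (m + i + 1).factorial * (m + i + j + 2).factorial) := by
      rcases Nat.eq_zero_or_pos j with rfl | hj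
      · simp
      · obtain ⟨j, rfl⟩ : ∃ k, j = k + 1 := ⟨j - 1, by omega⟩
        rw [if_pos hj, Nat.add_sub_cancel, ih i j m (by omega),
          show m + i + (j + 1) + 2 = (m + i + j + 2) + 1 by ring, Nat.factorial_succ (_ + 2)]
        have := Nat.factorial_ne_zero m
        have := Nat.factorial_ne_zero (m + i + 1)
        have := Nat.factorial_ne_zero (m + i + j + 2)
        push_cast
        field_simp
        ring
    have e3 : ((if 0 < i then walkCount tandemSteps (i - 1) (j + 1) n else 0 : ℕ) : ℚ) =
        (i * (j + 2) * (i + j + 2) * (m + i + 1) * n.factorial : ℚ) /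
        (m.factorial * (m + i + 1).factorial * (m + i + j + 2).factorial) := by
      rcases Nat.eq_zero_or_pos i with rfl | hi
      · simp
      · obtain ⟨i, rfl⟩ : ∃ k, i = k + 1 := ⟨i - 1, by omega⟩
        rw [if_pos hi, Nat.add_sub_cancel, ih i (j + 1) m (by omega),
          show m + (i + 1) + j + 2 = m + i + (j + 1) + 2 by ring,
          show m + (i + 1) + 1 = (m + i + 1) + 1 by ring, Nat.factorial_succ (m + i + 1)]
        have := Nat.factorial_ne_zero m
        have := Nat.factorial_ne_zero (m + i + 1)
        have := Nat.factorial_ne_zero (m + i + (j + 1) + 2)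
        push_cast
        field_simp
        ring
    have hn : ((n : ℚ) + 1) = 3 * m + 2 * i + j := by exact_mod_cast h
    rw [walkCount_succ, Nat.cast_add, Nat.cast_add, e1, e2, e3, Nat.factorial_succ n]
    push_cast
    rw [hn, ← add_div, ← add_div]
    congr 1
    ring

theorem walkCount_eq (i j m : ℕ) :
    (walkCount tandemSteps i j (3 * m + 2 * i + j) : ℚ) =
      ((i + 1) * (j + 1) * (i + j + 2) * (3 * m + 2 * i + j).factorial : ℚ) /
        (m.factorial * (m + i + 1).factorial * (m + i + j + 2).factorial) :=
  walkCount_mul_factorials _ i j m rfl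

theorem walkCount_origin (m : ℕ) :
    (walkCount tandemSteps 0 0 (3 * m) : ℚ) =
      (2 * (3 * m).factorial : ℚ) /
        (m.factorial * (m + 1).factorial * (m + 2).factorial) := by
  simpa using walkCount_eq 0 0 m

end Walks

/-! ### The rational series and its non-negative part -/

section NonnegPart

theorem coeff_mul_monoXY (f : LaurentXY) (c d a b : ℤ) :
    (f * monoXY c d).coeff (a, b) = f.coeff (a - c, b - d) := by
  rw [monoXY, AddMonoidAlgebra.coeff_mul_single_eq_coeff_mul (a - c, b - d), mul_one]
  rintro ⟨u, v⟩ _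
  simp only [Prod.mk_add_mk, Prod.mk.injEq]
  omega

theorem monoXY_mul_monoXY (a b c d : ℤ) : monoXY a b * monoXY c d = monoXY (a + c) (b + d) := by
  simp [monoXY]

theorem monoXY_pow (a b : ℤ) (n : ℕ) : monoXY a b ^ n = monoXY (n * a) (n * b) := by
  simp [monoXY, AddMonoidAlgebra.single_pow]

theorem coeff_monoXY (a b c d : ℤ) :
    (monoXY a b).coeff (c, d) = if a = c ∧ b = d then 1 else 0 := by
  classical
  simp [monoXY, Finsupp.single_apply]

/-- The six exponents are the orbit of $(0,0)$ under $(a,b)\mapsto(-a-2,a+b+1)$ and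
$(a,b)\mapsto(a+b+1,-b-2)$, each with the sign of the group element. -/
theorem tandemNumerator_eq : tandemNumerator =
    monoXY 0 0 - monoXY (-2) 1 - monoXY 1 (-2) + monoXY (-3) 0 + monoXY 0 (-3)
      - monoXY (-2) (-2) := by
  have h1 : (1 : LaurentXY) = monoXY 0 0 := rfl
  rw [tandemNumerator, h1]
  simp only [mul_sub, sub_mul, monoXY_mul_monoXY]
  norm_num
  abel

/-- The coefficient of `x ^ a * y ^ b * t ^ n` in the rational series. -/
noncomputable def rationalCoeff (n : ℕ) (a b : ℤ) : ℚ := (PowerSeries.coeff n tandemRational).coeff (a, b)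

theorem rationalCoeff_zero (a b : ℤ) : rationalCoeff 0 a b =
    (if 0 = a ∧ 0 = b then 1 else 0) - (if -2 = a ∧ 1 = b then 1 else 0)
      - (if 1 = a ∧ -2 = b then 1 else 0) + (if -3 = a ∧ 0 = b then 1 else 0)
      + (if 0 = a ∧ -3 = b then 1 else 0) - (if -2 = a ∧ -2 = b then 1 else 0) := by
  have h : PowerSeries.coeff 0 tandemRational = tandemNumerator := by
    have := congrArg (PowerSeries.coeff 0) tandemRational_mul_denominator
    simpa [tandemDenominator] using this
  simp only [rationalCoeff, h, tandemNumerator_eq, AddMonoidAlgebra.coeff_add,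
    AddMonoidAlgebra.coeff_sub, Finsupp.add_apply, Finsupp.sub_apply, coeff_monoXY]

theorem rationalCoeff_succ (n : ℕ) (a b : ℤ) : rationalCoeff (n + 1) a b =
    rationalCoeff n (a + 1) b + rationalCoeff n a (b - 1) + rationalCoeff n (a - 1) (b + 1) := by
  have h : PowerSeries.coeff (n + 1) tandemRational =
      PowerSeries.coeff n tandemRational * (monoXY (-1) 0 + monoXY 0 1 + monoXY 1 (-1)) := by
    have := congrArg (PowerSeries.coeff (n + 1)) tandemRational_mul_denominator
    rw [tandemDenominator, mul_sub, mul_one, mul_left_comm, map_sub,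
      PowerSeries.coeff_succ_X_mul, PowerSeries.coeff_mul_C, PowerSeries.coeff_C,
      if_neg (Nat.succ_ne_zero n), sub_eq_zero] at this
    exact this
  simp only [rationalCoeff, h, mul_add, AddMonoidAlgebra.coeff_add, Finsupp.add_apply,
    coeff_mul_monoXY, sub_neg_eq_add, sub_zero]

/-- Reflection in the line `a = -1`. -/
theorem rationalCoeff_reflect_left (n : ℕ) : ∀ a b : ℤ,
    rationalCoeff n (-a - 2) (a + b + 1) = -rationalCoeff n a b := by
  induction n with
  | zero =>
    intro a b
    have c0 : (0 = -a - 2 ∧ 0 = a + b + 1) ↔ (-2 = a ∧ 1 = b) := by omega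
    have c1 : (-2 = -a - 2 ∧ 1 = a + b + 1) ↔ (0 = a ∧ 0 = b) := by omega
    have c2 : (1 = -a - 2 ∧ -2 = a + b + 1) ↔ (-3 = a ∧ 0 = b) := by omega
    have c3 : (-3 = -a - 2 ∧ 0 = a + b + 1) ↔ (1 = a ∧ -2 = b) := by omega
    have c4 : (0 = -a - 2 ∧ -3 = a + b + 1) ↔ (-2 = a ∧ -2 = b) := by omega
    have c5 : (-2 = -a - 2 ∧ -2 = a + b + 1) ↔ (0 = a ∧ -3 = b) := by omega
    simp only [rationalCoeff_zero, c0, c1, c2, c3, c4, c5]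
    ring
  | succ n ih =>
    intro a b
    -- The reflection exchanges the predecessors by W and SE and keeps the one by N.
    have h1 := ih (a + 1) b
    have h2 := ih a (b - 1)
    have h3 := ih (a - 1) (b + 1)
    rw [show -(a + 1) - 2 = -a - 2 - 1 by ring, show a + 1 + b + 1 = a + b + 1 + 1 by ring] at h1
    rw [show a + (b - 1) + 1 = a + b + 1 - 1 by ring] at h2
    rw [show -(a - 1) - 2 = -a - 2 + 1 by ring, show a - 1 + (b + 1) + 1 = a + b + 1 by ring] at h3
    rw [rationalCoeff_succ, rationalCoeff_succ, h1, h2, h3]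
    ring

/-- Reflection in the line `b = -1`. -/
theorem rationalCoeff_reflect_right (n : ℕ) : ∀ a b : ℤ,
    rationalCoeff n (a + b + 1) (-b - 2) = -rationalCoeff n a b := by
  induction n with
  | zero =>
    intro a b
    have c0 : (0 = a + b + 1 ∧ 0 = -b - 2) ↔ (1 = a ∧ -2 = b) := by omega
    have c1 : (-2 = a + b + 1 ∧ 1 = -b - 2) ↔ (0 = a ∧ -3 = b) := by omega
    have c2 : (1 = a + b + 1 ∧ -2 = -b - 2) ↔ (0 = a ∧ 0 = b) := by omega
    have c3 : (-3 = a + b + 1 ∧ 0 = -b - 2) ↔ (-2 = a ∧ -2 = b) := by omega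
    have c4 : (0 = a + b + 1 ∧ -3 = -b - 2) ↔ (-2 = a ∧ 1 = b) := by omega
    have c5 : (-2 = a + b + 1 ∧ -2 = -b - 2) ↔ (-3 = a ∧ 0 = b) := by omega
    simp only [rationalCoeff_zero, c0, c1, c2, c3, c4, c5]
    ring
  | succ n ih =>
    intro a b
    -- Here the predecessors by N and SE are exchanged and the one by W is kept.
    have h1 := ih (a + 1) b
    have h2 := ih a (b - 1)
    have h3 := ih (a - 1) (b + 1)
    rw [show a + 1 + b + 1 = a + b + 1 + 1 by ring] at h1
    rw [show -(b - 1) - 2 = -b - 2 + 1 by ring, show a + (b - 1) + 1 = a + b + 1 - 1 by ring] at h2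
    rw [show -(b + 1) - 2 = -b - 2 - 1 by ring, show a - 1 + (b + 1) + 1 = a + b + 1 by ring] at h3
    rw [rationalCoeff_succ, rationalCoeff_succ, h1, h2, h3]
    ring

/-- The reflection fixes the points of this line, so the coefficient equals its own negative. -/
theorem rationalCoeff_neg_one_left (n : ℕ) (b : ℤ) : rationalCoeff n (-1) b = 0 := by
  have := rationalCoeff_reflect_left n (-1) b
  norm_num at this
  linarith

theorem rationalCoeff_neg_one_right (n : ℕ) (a : ℤ) : rationalCoeff n a (-1) = 0 := by
  have := rationalCoeff_reflect_right n a (-1)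
  norm_num at this
  linarith

/-- From a point of the quadrant, a predecessor outside it lies on $a=-1$ or $b=-1$. There the
coefficients vanish, which matches the guards of `walkCount_succ`. -/
theorem rationalCoeff_eq_walkCount (n : ℕ) : ∀ i j : ℕ,
    rationalCoeff n i j = walkCount tandemSteps i j n := by
  induction n with
  | zero =>
    intro i j
    rw [rationalCoeff_zero, walkCount_zero]
    push_cast
    grind
  | succ n ih =>
    intro i j
    rw [rationalCoeff_succ, walkCount_succ, Nat.cast_add, Nat.cast_add, ← add_assoc]
    congr 1
    · congr 1
      · exact_mod_cast ih (i + 1) j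
      · split_ifs with h
        · rw [← ih]; congr 1; omega
        · obtain rfl : j = 0 := by omega
          exact_mod_cast rationalCoeff_neg_one_right n i
    · split_ifs with h
      · rw [← ih]; congr 1; omega
      · obtain rfl : i = 0 := by omega
        exact_mod_cast rationalCoeff_neg_one_left n (j + 1)

theorem specialize_walkSeries {A : Type*} [CommRing A] [Algebra ℚ A] (u v : A)
    (S : Finset (ℤ × ℤ)) (n : ℕ) :
    PowerSeries.coeff n (specialize u v (walkSeries S)) =
      ∑ w ∈ quadrantWalks S n, u ^ (walkPos w n).1.toNat * v ^ (walkPos w n).2.toNat := by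
  simp [specialize, walkSeries]

theorem specialize_walkSeries_eq_nonnegPart :
    specialize (monoXY 1 0) (monoXY 0 1) (walkSeries tandemSteps) = nonnegPart tandemRational := by
  refine PowerSeries.ext fun n => ?_
  rw [specialize_walkSeries, nonnegPart, PowerSeries.coeff_mk]
  refine AddMonoidAlgebra.ext (Finsupp.ext fun p => ?_)
  obtain ⟨a, b⟩ := p
  rw [nonnegPartXY, AddMonoidAlgebra.coeff_sum, Finsupp.finsetSum_apply,
    AddMonoidAlgebra.coeff_ofCoeff, Finsupp.filter_apply]
  simp only [monoXY_pow, monoXY_mul_monoXY, coeff_monoXY]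
  split_ifs with h
  · obtain ⟨i, rfl⟩ := Int.eq_ofNat_of_zero_le h.1
    obtain ⟨j, rfl⟩ := Int.eq_ofNat_of_zero_le h.2
    change _ = rationalCoeff n i j
    rw [rationalCoeff_eq_walkCount, ← sum_quadrantWalks_ite_eq]
    refine Finset.sum_congr rfl fun w hw => if_congr ?_ rfl rfl
    have := quadrantWalks_end_nonneg hw
    rw [Prod.ext_iff]
    simp only
    omega
  · refine Finset.sum_eq_zero fun w hw => if_neg ?_
    have := quadrantWalks_end_nonneg hw
    omega

end NonnegPart

/-! ### Tandem walks with a given number of steps `SE`, and Motzkin numbers -/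

section Motzkin

/-- The number of Motzkin paths of length `n` with `k` up steps. -/
def motzkinCoeff (n k : ℕ) : ℕ := n.choose (2 * k) * catalan k

theorem cast_catalan_eq (k : ℕ) :
    (catalan k : ℚ) = (2 * k).factorial / (k.factorial * (k + 1).factorial) := by
  have h : (((k + 1) * catalan k : ℕ) : ℚ) = Nat.centralBinom k := by
    rw [succ_mul_catalan_eq_centralBinom]
  rw [Nat.centralBinom_eq_two_mul_choose, Nat.cast_choose ℚ (by omega : k ≤ 2 * k),
    show 2 * k - k = k by omega] at h
  have h0 : (k.factorial : ℚ) ≠ 0 := by exact_mod_cast Nat.factorial_ne_zero k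
  rw [Nat.factorial_succ]
  push_cast at h ⊢
  field_simp at h ⊢
  linarith

theorem cast_motzkinCoeff_eq (d k : ℕ) :
    (motzkinCoeff (d + 2 * k) k : ℚ) =
      (d + 2 * k).factorial / (d.factorial * k.factorial * (k + 1).factorial) := by
  rw [motzkinCoeff, Nat.cast_mul, cast_catalan_eq,
    Nat.cast_choose ℚ (by omega : 2 * k ≤ d + 2 * k), Nat.add_sub_cancel]
  have h0 : ((2 * k).factorial : ℚ) ≠ 0 := by exact_mod_cast Nat.factorial_ne_zero _
  have h1 : (k.factorial : ℚ) ≠ 0 := by exact_mod_cast Nat.factorial_ne_zero k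
  have h2 : (d.factorial : ℚ) ≠ 0 := by exact_mod_cast Nat.factorial_ne_zero d
  have h3 : ((k + 1).factorial : ℚ) ≠ 0 := by exact_mod_cast Nat.factorial_ne_zero _
  field_simp

theorem motzkinCoeff_eq_zero {n k : ℕ} (h : n < 2 * k) : motzkinCoeff n k = 0 := by
  rw [motzkinCoeff, Nat.choose_eq_zero_of_lt h, zero_mul]

/-- The factor $d(d-1)$ makes the formula valid for $d=0,1$ too, where the binomial is zero, so that
later recurrences need no separate boundary cases. -/
theorem cast_motzkinCoeff_eq' {n d k : ℕ} (h : n + 2 = d + 2 * k) :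
    (motzkinCoeff n k : ℚ) =
      d * (d - 1) * n.factorial / (d.factorial * k.factorial * (k + 1).factorial) := by
  rcases d with _ | _ | d
  · rw [motzkinCoeff_eq_zero (by omega)]; simp
  · rw [motzkinCoeff_eq_zero (by omega)]; simp
  · obtain rfl : n = d + 2 * k := by omega
    rw [cast_motzkinCoeff_eq, Nat.factorial_succ (d + 1), Nat.factorial_succ d]
    have h1 : (k.factorial : ℚ) ≠ 0 := by exact_mod_cast Nat.factorial_ne_zero k
    have h2 : (d.factorial : ℚ) ≠ 0 := by exact_mod_cast Nat.factorial_ne_zero d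
    have h3 : ((k + 1).factorial : ℚ) ≠ 0 := by exact_mod_cast Nat.factorial_ne_zero _
    push_cast
    field_simp
    ring

/-- The number of tandem walks of length `n` with `k` steps `SE`. -/
def tandemCountSE (n k : ℕ) : ℕ :=
  ∑ w ∈ quadrantWalks tandemSteps n,
    -- A step W or N leaves $n+i-j$ unchanged, and a step SE adds 3 to it.
    if (n : ℤ) + (walkPos w n).1 - (walkPos w n).2 = 3 * k then 1 else 0

theorem tandemCountSE_zero (k : ℕ) : tandemCountSE 0 k = if k = 0 then 1 else 0 := by
  rw [tandemCountSE, sum_quadrantWalks_zero tandemSteps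
    fun p => if ((0 : ℕ) : ℤ) + p.1 - p.2 = 3 * k then 1 else 0]
  refine if_congr ?_ rfl rfl
  simp [eq_comm]

/-- The number of walks to which no step `W` can be added. -/
theorem sum_ite_first_eq_zero (n k : ℕ) :
    ∑ w ∈ quadrantWalks tandemSteps n,
      (if (walkPos w n).1 = 0 ∧ (n : ℤ) + (walkPos w n).1 - (walkPos w n).2 = 3 * k
        then 1 else 0) = if 3 * k ≤ n then walkCount tandemSteps 0 (n - 3 * k) n else 0 := by
  split_ifs with h
  · rw [← Nat.cast_id (walkCount _ _ _ _), ← sum_quadrantWalks_ite_eq]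
    refine Finset.sum_congr rfl fun w _ => if_congr ?_ rfl rfl
    rw [Prod.ext_iff]
    simp only
    omega
  · refine Finset.sum_eq_zero fun w hw => if_neg ?_
    have := quadrantWalks_end_nonneg hw
    omega

/-- The number of walks to which no step `SE` can be added. -/
theorem sum_ite_second_eq_zero (n k : ℕ) :
    ∑ w ∈ quadrantWalks tandemSteps n,
      (if (walkPos w n).2 = 0 ∧ (n : ℤ) + (walkPos w n).1 - (walkPos w n).2 = 3 * k
        then 1 else 0) = if n ≤ 3 * k then walkCount tandemSteps (3 * k - n) 0 n else 0 := by
  split_ifs with h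
  · rw [← Nat.cast_id (walkCount _ _ _ _), ← sum_quadrantWalks_ite_eq]
    refine Finset.sum_congr rfl fun w _ => if_congr ?_ rfl rfl
    rw [Prod.ext_iff]
    simp only
    omega
  · refine Finset.sum_eq_zero fun w hw => if_neg ?_
    have := quadrantWalks_end_nonneg hw
    omega

theorem tandemCountSE_succ_zero (n : ℕ) :
    tandemCountSE (n + 1) 0 + walkCount tandemSteps 0 n n = 2 * tandemCountSE n 0 := by
  have h := sum_ite_first_eq_zero n 0
  simp only [mul_zero, zero_le, if_true, Nat.sub_zero] at h
  rw [← h, tandemCountSE, sum_tandemWalks_succ n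
    fun p => if ((n + 1 : ℕ) : ℤ) + p.1 - p.2 = 3 * (0 : ℕ) then 1 else 0,
    tandemCountSE, Finset.mul_sum, ← Finset.sum_add_distrib]
  refine Finset.sum_congr rfl fun w hw => ?_
  have := quadrantWalks_end_nonneg hw
  -- This gives $n+i-j=3(m+i)\ge0$, so an appended SE step cannot produce a walk counted by $k=0$.
  obtain ⟨m, hm⟩ := exists_length_eq hw
  generalize walkPos w n = p at *
  push_cast
  split_ifs <;> omega

/-- Appending W or N keeps the number of SE steps and appending SE raises it by one. The two extra
terms on the left count the extensions forbidden at the axes. -/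
theorem tandemCountSE_succ_succ (n k : ℕ) :
    tandemCountSE (n + 1) (k + 1)
        + (if 3 * (k + 1) ≤ n then walkCount tandemSteps 0 (n - 3 * (k + 1)) n else 0)
        + (if n ≤ 3 * k then walkCount tandemSteps (3 * k - n) 0 n else 0) =
      2 * tandemCountSE n (k + 1) + tandemCountSE n k := by
  rw [← sum_ite_first_eq_zero, ← sum_ite_second_eq_zero, tandemCountSE, sum_tandemWalks_succ n
    fun p => if ((n + 1 : ℕ) : ℤ) + p.1 - p.2 = 3 * (k + 1 : ℕ) then 1 else 0,
    tandemCountSE, tandemCountSE, Finset.mul_sum, ← Finset.sum_add_distrib,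
    ← Finset.sum_add_distrib, ← Finset.sum_add_distrib]
  refine Finset.sum_congr rfl fun w hw => ?_
  have := quadrantWalks_end_nonneg hw
  generalize walkPos w n = p at *
  push_cast
  split_ifs <;> omega

/-- With $n=d+2k$ the two guards read $d\ge k+3$ and $d\le k$. The hook formula gives the same
expression in both ranges, and its numerator vanishes at the two values left out, $d=k+1$ and
$d=k+2$. -/
theorem walkCount_boundary {n d k : ℕ} (h : n + 2 = d + 2 * (k + 1)) :
    (((if 3 * (k + 1) ≤ n then walkCount tandemSteps 0 (n - 3 * (k + 1)) n else 0)
      + (if n ≤ 3 * k then walkCount tandemSteps (3 * k - n) 0 n else 0) : ℕ) : ℚ) =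
      (d - k - 1 : ℚ) * (d - k - 2) * n.factorial /
        (d.factorial * (k + 1).factorial * (k + 1 + 1).factorial) := by
  have h1 : ((k + 1).factorial : ℚ) ≠ 0 := by exact_mod_cast Nat.factorial_ne_zero _
  have h2 : (d.factorial : ℚ) ≠ 0 := by exact_mod_cast Nat.factorial_ne_zero d
  have h3 : ((k + 1 + 1).factorial : ℚ) ≠ 0 := by exact_mod_cast Nat.factorial_ne_zero _
  obtain rfl : n = d + 2 * k := by omega
  split_ifs with ha hb hb
  · omega
  · obtain ⟨e, rfl⟩ : ∃ e, d = k + 3 + e := ⟨d - (k + 3), by omega⟩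
    rw [show k + 3 + e + 2 * k - 3 * (k + 1) = e by omega, add_zero,
      walkCount_mul_factorials _ 0 e (k + 1) (by ring),
      show k + 1 + 0 + e + 2 = k + 3 + e by ring]
    push_cast
    field_simp
    ring
  · obtain ⟨i, rfl⟩ : ∃ i, k = d + i := ⟨k - d, by omega⟩
    rw [show 3 * (d + i) - (d + 2 * (d + i)) = i by omega, zero_add,
      walkCount_mul_factorials _ i 0 d (by ring),
      show d + i + 0 + 2 = d + i + 1 + 1 by ring]
    push_cast
    field_simp
    ring
  · have hd : d = k + 1 ∨ d = k + 2 := by omega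
    rcases hd with rfl | rfl <;> simp

/-- The boundary terms of the recurrence are known from the hook formula, so it determines the
counts; it remains to see that $\binom n{2k}\mathrm{Cat}_k$ satisfies it. -/
theorem tandemCountSE_eq (n : ℕ) : ∀ k : ℕ, tandemCountSE n k = motzkinCoeff n k := by
  induction n with
  | zero =>
    intro k
    rw [tandemCountSE_zero]
    rcases k with _ | k
    · simp [motzkinCoeff]
    · simp [motzkinCoeff_eq_zero]
  | succ n ih =>
    intro k
    rcases k with _ | k
    · have h := tandemCountSE_succ_zero n
      have h1 : walkCount tandemSteps 0 n n = 1 := by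
        have := walkCount_mul_factorials n 0 n 0 (by ring)
        have h0 : (n.factorial : ℚ) ≠ 0 := by exact_mod_cast Nat.factorial_ne_zero n
        rw [show 0 + 0 + n + 2 = n + 2 by ring, Nat.factorial_succ (n + 1),
          Nat.factorial_succ n] at this
        push_cast at this
        have h2 : (walkCount tandemSteps 0 n n : ℚ) = 1 := by
          rw [this]
          simp
          field_simp
          ring
        exact_mod_cast h2
      rw [ih, h1] at h
      simp only [motzkinCoeff] at *
      simp at *
      omega
    · have h := tandemCountSE_succ_succ n k
      rw [ih, ih, add_assoc] at h
      rcases lt_or_ge (n + 2) (2 * (k + 1)) with hn | hn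
      · rw [motzkinCoeff_eq_zero (by omega : n < 2 * (k + 1)),
          motzkinCoeff_eq_zero (by omega : n < 2 * k)] at h
        rw [motzkinCoeff_eq_zero (by omega)]
        omega
      · obtain ⟨d, hd⟩ : ∃ d, n + 2 = d + 2 * (k + 1) := ⟨n + 2 - 2 * (k + 1), by omega⟩
        have hq := congrArg (Nat.cast : ℕ → ℚ) h
        rw [Nat.cast_add, walkCount_boundary hd] at hq
        have e1 := cast_motzkinCoeff_eq' hd
        have hn : n = d + 2 * k := by omega
        have e2 := cast_motzkinCoeff_eq d k
        have e3 := cast_motzkinCoeff_eq' (show n + 1 + 2 = (d + 1) + 2 * (k + 1) by omega)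
        rw [← hn] at e2
        rw [← @Nat.cast_inj ℚ, eq_sub_of_add_eq hq, Nat.cast_add, Nat.cast_mul, e1, e2, e3]
        have h1 : (k.factorial : ℚ) ≠ 0 := by exact_mod_cast Nat.factorial_ne_zero _
        have h2 : (d.factorial : ℚ) ≠ 0 := by exact_mod_cast Nat.factorial_ne_zero d
        have h3 : (n : ℚ) = d + 2 * k := by exact_mod_cast hn
        rw [Nat.factorial_succ (k + 1), Nat.factorial_succ k, Nat.factorial_succ d,
          Nat.factorial_succ n]
        push_cast
        rw [h3]
        field_simp
        ring

/-- A sum over the endpoints of tandem walks that depends only on the number of steps `SE`. -/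
theorem sum_tandemWalks_eq_sum_motzkinCoeff {R : Type*} [Semiring R] (n : ℕ) (φ : ℤ → R) :
    ∑ w ∈ quadrantWalks tandemSteps n, φ ((walkPos w n).1 - (walkPos w n).2) =
      ∑ k ∈ Finset.range (n / 2 + 1), (motzkinCoeff n k : R) * φ (3 * k - n) := by
  have hk : ∀ w ∈ quadrantWalks tandemSteps n, ∃ k ∈ Finset.range (n + 1),
      (n : ℤ) + (walkPos w n).1 - (walkPos w n).2 = 3 * k := by
    intro w hw
    have h := quadrantWalks_end_nonneg hw
    obtain ⟨m, hm⟩ := exists_length_eq hw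
    -- Since $n=3m+2i+j$, the number of SE steps is $(n+i-j)/3=m+i$.
    refine ⟨m + (walkPos w n).1.toNat, ?_, ?_⟩
    · rw [Finset.mem_range]; omega
    · push_cast
      omega
  have hsub : Finset.range (n / 2 + 1) ⊆ Finset.range (n + 1) := by
    intro k; simp only [Finset.mem_range]; omega
  rw [Finset.sum_subset hsub]
  · have : ∀ k ∈ Finset.range (n + 1), (motzkinCoeff n k : R) * φ (3 * k - n) =
        ∑ w ∈ quadrantWalks tandemSteps n,
          if (n : ℤ) + (walkPos w n).1 - (walkPos w n).2 = 3 * k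
            then φ ((walkPos w n).1 - (walkPos w n).2) else 0 := by
      intro k _
      rw [← tandemCountSE_eq, tandemCountSE, Nat.cast_sum, Finset.sum_mul]
      refine Finset.sum_congr rfl fun w _ => ?_
      split_ifs with h
      · rw [Nat.cast_one, one_mul]; congr 1; omega
      · simp
    rw [Finset.sum_congr rfl this, Finset.sum_comm]
    refine Finset.sum_congr rfl fun w hw => ?_
    obtain ⟨k, hk1, hk2⟩ := hk w hw
    rw [Finset.sum_eq_single k, if_pos hk2]
    · intro l _ hl
      rw [if_neg]
      omega
    · intro h; exact absurd hk1 h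
  · intro k _ hk
    rw [Finset.mem_range] at hk
    rw [motzkinCoeff_eq_zero (by omega)]
    simp

end Motzkin

/-! ### Generating functions of Motzkin paths -/

section MotzkinSeries

/-- Choose $r+s+1$ of $n+1$ points in a row, and sort the choices by the position of the $(r+1)$-st
chosen point. -/
theorem sum_antidiagonal_choose_mul_choose (n : ℕ) : ∀ r s : ℕ,
    ∑ p ∈ Finset.HasAntidiagonal.antidiagonal n, p.1.choose r * p.2.choose s = (n + 1).choose (r + s + 1) := by
  induction n with
  | zero =>
    intro r s
    rcases r with _ | r <;> rcases s with _ | s <;> simp [Nat.choose_eq_zero_of_lt]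
  | succ n ih =>
    intro r s
    rw [Finset.Nat.sum_antidiagonal_succ]
    rcases r with _ | r
    · have := ih 0 s
      simp only [Nat.choose_zero_right, one_mul, zero_add] at this ⊢
      rw [this, Nat.choose_succ_succ (n + 1)]
    · simp only [Nat.choose_succ_succ _ r, add_mul, Finset.sum_add_distrib, ih,
        Nat.choose_zero_succ, zero_mul, zero_add]
      rw [show r + 1 + s + 1 = (r + s + 1) + 1 by ring, Nat.choose_succ_succ (n + 1)]

theorem motzkinCoeff_zero_right (n : ℕ) : motzkinCoeff n 0 = 1 := by
  simp [motzkinCoeff]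

/-- A Motzkin path starts with a level step, or with an up step whose matching down step cuts the
rest into two Motzkin paths. Algebraically this combines Pascal's rule, the Catalan recurrence and
the preceding convolution. -/
theorem motzkinCoeff_add_two (n k : ℕ) : motzkinCoeff (n + 2) (k + 1) =
    motzkinCoeff (n + 1) (k + 1) + ∑ p ∈ Finset.HasAntidiagonal.antidiagonal n, ∑ q ∈ Finset.HasAntidiagonal.antidiagonal k,
      motzkinCoeff p.1 q.1 * motzkinCoeff p.2 q.2 := by
  have h : ∑ p ∈ Finset.HasAntidiagonal.antidiagonal n, ∑ q ∈ Finset.HasAntidiagonal.antidiagonal k,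
      motzkinCoeff p.1 q.1 * motzkinCoeff p.2 q.2 =
      (n + 1).choose (2 * k + 1) * catalan (k + 1) := by
    rw [Finset.sum_comm, catalan_succ', Finset.mul_sum]
    refine Finset.sum_congr rfl fun q hq => ?_
    rw [Finset.HasAntidiagonal.mem_antidiagonal] at hq
    rw [← hq, mul_add, ← sum_antidiagonal_choose_mul_choose, Finset.sum_mul]
    refine Finset.sum_congr rfl fun p _ => ?_
    simp only [motzkinCoeff]
    ring
  rw [h, motzkinCoeff, motzkinCoeff, show 2 * (k + 1) = 2 * k + 1 + 1 by ring,
    Nat.choose_succ_succ (n + 1), add_mul, add_comm]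

/-- The generating polynomial of Motzkin paths of length `n` by the number of up steps. -/
noncomputable def motzkinPoly (n : ℕ) : Polynomial ℕ :=
  ∑ k ∈ Finset.range (n / 2 + 1), Polynomial.monomial k (motzkinCoeff n k)

theorem coeff_motzkinPoly (n k : ℕ) : (motzkinPoly n).coeff k = motzkinCoeff n k := by
  simp only [motzkinPoly, Polynomial.finsetSum_coeff, Polynomial.coeff_monomial]
  rw [Finset.sum_ite_eq' (Finset.range (n / 2 + 1)) k]
  split_ifs with h
  · rfl
  · rw [Finset.mem_range] at h
    rw [motzkinCoeff_eq_zero (by omega)]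

theorem motzkinPoly_zero : motzkinPoly 0 = 1 := by
  simp [motzkinPoly, motzkinCoeff]

theorem motzkinPoly_one : motzkinPoly 1 = 1 := by
  simp [motzkinPoly, motzkinCoeff]

theorem motzkinPoly_add_two (n : ℕ) : motzkinPoly (n + 2) = motzkinPoly (n + 1) +
    Polynomial.X * ∑ p ∈ Finset.HasAntidiagonal.antidiagonal n, motzkinPoly p.1 * motzkinPoly p.2 := by
  ext k
  rcases k with _ | k
  · simp [coeff_motzkinPoly, motzkinCoeff_zero_right]
  · rw [Polynomial.coeff_add, Polynomial.coeff_X_mul, Polynomial.finsetSum_coeff]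
    simp only [Polynomial.coeff_mul, coeff_motzkinPoly, motzkinCoeff_add_two]

/-- The generating function of Motzkin paths: a level step has weight `a`, and an up step
together with a down step has weight `c * a ^ 2`. -/
noncomputable def motzkinSeries {A : Type*} [CommRing A] (a c : A) : PowerSeries A :=
  PowerSeries.mk fun n => a ^ n * Polynomial.eval₂ (Nat.castRingHom A) c (motzkinPoly n)

theorem coeff_motzkinSeries {A : Type*} [CommRing A] (a c : A) (n : ℕ) :
    PowerSeries.coeff n (motzkinSeries a c) =
      a ^ n * ∑ k ∈ Finset.range (n / 2 + 1), (motzkinCoeff n k : A) * c ^ k := by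
  rw [motzkinSeries, PowerSeries.coeff_mk, motzkinPoly, Polynomial.eval₂_finsetSum]
  simp

theorem motzkinSeries_eq {A : Type*} [CommRing A] (a c : A) :
    motzkinSeries a c = 1 + PowerSeries.C a * PowerSeries.X * motzkinSeries a c +
      PowerSeries.C (c * a ^ 2) * PowerSeries.X ^ 2 * motzkinSeries a c ^ 2 := by
  have h2 : ∀ (F : PowerSeries A) (n : ℕ),
      PowerSeries.coeff (n + 2) (PowerSeries.X ^ 2 * F) = PowerSeries.coeff n F :=
    fun F n => PowerSeries.coeff_X_pow_mul F 2 n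
  ext n
  rw [mul_assoc, mul_assoc, map_add, map_add, PowerSeries.coeff_C_mul, PowerSeries.coeff_C_mul]
  rcases n with _ | _ | n
  · simp [motzkinSeries, motzkinPoly_zero]
  · rw [PowerSeries.coeff_succ_X_mul, PowerSeries.coeff_X_pow_mul']
    simp [motzkinSeries, motzkinPoly_zero, motzkinPoly_one, PowerSeries.coeff_one]
  · rw [h2, PowerSeries.coeff_succ_X_mul, pow_two (motzkinSeries a c), PowerSeries.coeff_mul]
    simp only [motzkinSeries, PowerSeries.coeff_mk, motzkinPoly_add_two, PowerSeries.coeff_one,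
      Polynomial.eval₂_add, Polynomial.eval₂_mul, Polynomial.eval₂_X,
      Polynomial.eval₂_finsetSum]
    rw [if_neg (by omega), zero_add, mul_add, Finset.mul_sum, Finset.mul_sum, Finset.mul_sum]
    congr 1
    · ring
    · refine Finset.sum_congr rfl fun p hp => ?_
      rw [Finset.HasAntidiagonal.mem_antidiagonal] at hp
      rw [← hp]
      ring

/-- The discriminant of the quadratic equation of `motzkinSeries` is a square. -/
theorem isSeriesSqrt_motzkinSeries {A : Type*} [CommRing A] (a c : A) :
    IsSeriesSqrt (1 - PowerSeries.C a * PowerSeries.X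
      - 2 * (PowerSeries.C (c * a ^ 2) * PowerSeries.X ^ 2) * motzkinSeries a c)
      ((1 - PowerSeries.C a * PowerSeries.X) ^ 2
        - 4 * (PowerSeries.C (c * a ^ 2) * PowerSeries.X ^ 2)) := by
  refine ⟨?_, by simp⟩
  linear_combination (-4 * (PowerSeries.C (c * a ^ 2) * PowerSeries.X ^ 2)) * motzkinSeries_eq a c

theorem motzkinPoly_eval_one (n : ℕ) : (motzkinPoly n).eval 1 = motzkinNumber n := by
  induction n using Nat.strong_induction_on with
  | _ n ih =>
    rcases n with _ | _ | n
    · simp [motzkinPoly_zero, motzkinNumber]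
    · simp [motzkinPoly_one, motzkinNumber]
    · rw [motzkinPoly_add_two, motzkinNumber, Polynomial.eval_add, ih (n + 1) (by omega),
        Polynomial.eval_mul, Polynomial.eval_X, one_mul, Polynomial.eval_finsetSum,
        Finset.Nat.sum_antidiagonal_eq_sum_range_succ_mk, ← Fin.sum_univ_eq_sum_range]
      refine congrArg _ (Finset.sum_congr rfl fun k _ => ?_)
      have hk := k.2
      rw [Polynomial.eval_mul, ih _ (by omega), ih _ (by omega)]
      simp

theorem card_quadrantWalks_eq_motzkinNumber (n : ℕ) :
    (quadrantWalks tandemSteps n).card = motzkinNumber n := by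
  have h := sum_tandemWalks_eq_sum_motzkinCoeff (R := ℕ) n fun _ => 1
  rw [← motzkinPoly_eval_one, motzkinPoly, Polynomial.eval_finsetSum]
  simpa using h

theorem specialize_one_one :
    specialize (1 : ℚ) 1 (walkSeries tandemSteps) = motzkinSeries 1 1 := by
  ext n
  rw [specialize_walkSeries, coeff_motzkinSeries]
  have h := sum_tandemWalks_eq_sum_motzkinCoeff (R := ℚ) n fun _ => 1
  simpa using h

/-- At $y=1/x$ a walk with $k$ SE steps has weight $x^{i-j}=x^{3k-n}$: a factor $x^{-1}$ per step
and $x^3$ per SE step. -/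
theorem specialize_inv {K : Type*} [Field K] [Algebra ℚ K] {x : K} (hx : x ≠ 0) :
    specialize x x⁻¹ (walkSeries tandemSteps) = motzkinSeries x⁻¹ (x ^ 3) := by
  ext n
  rw [specialize_walkSeries, coeff_motzkinSeries, Finset.mul_sum]
  have h := sum_tandemWalks_eq_sum_motzkinCoeff (R := K) n fun e => x ^ e
  rw [← Finset.sum_congr rfl fun w hw => ?_, h]
  · refine Finset.sum_congr rfl fun k _ => ?_
    rw [zpow_sub₀ hx, zpow_natCast, zpow_mul, zpow_natCast, div_eq_mul_inv, inv_pow]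
    norm_cast
    ring
  · have hw := quadrantWalks_end_nonneg hw
    rw [zpow_sub₀ hx, ← zpow_natCast, ← zpow_natCast, Int.toNat_of_nonneg hw.1,
      Int.toNat_of_nonneg hw.2, inv_zpow, div_eq_mul_inv]

theorem specialize_one_one_eq_mk :
    specialize (1 : ℚ) 1 (walkSeries tandemSteps) =
      PowerSeries.mk (fun n : ℕ => ∑ k ∈ Finset.range (n / 2 + 1),
        (1 / ((k : ℚ) + 1)) * (n.choose (2 * k) : ℚ) * ((2 * k).choose k : ℚ)) := by
  ext n
  rw [specialize_one_one, coeff_motzkinSeries, PowerSeries.coeff_mk, one_pow, one_mul]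
  refine Finset.sum_congr rfl fun k _ => ?_
  have h : (((k + 1) * catalan k : ℕ) : ℚ) = Nat.centralBinom k := by
    rw [succ_mul_catalan_eq_centralBinom]
  rw [← Nat.centralBinom_eq_two_mul_choose, ← h, motzkinCoeff]
  push_cast
  field_simp
  simp

theorem toLaurent_injective {K : Type*} [Field K] :
    Function.Injective (toLaurent : PowerSeries K → LaurentSeries K) :=
  HahnSeries.ofPowerSeries_injective

/-- The denominators of interest are multiples of $t^2$, which are not invertible among power
series, so the quotient lives in $K((t))$. -/
theorem toLaurent_eq_div {K : Type*} [Field K] {F G H : PowerSeries K} (hH : H ≠ 0)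
    (h : H * F = G) : toLaurent F = toLaurent G / toLaurent H := by
  have h0 : toLaurent H ≠ 0 := by
    intro h'
    exact hH (toLaurent_injective (h'.trans (map_zero _).symm))
  rw [eq_div_iff h0, ← h, mul_comm]
  exact (map_mul _ _ _).symm

theorem two_ne_zero_powerSeries {K : Type*} [Field K] [CharZero K] : (2 : PowerSeries K) ≠ 0 := by
  intro h
  have := congrArg PowerSeries.constantCoeff h
  rw [map_ofNat, map_zero] at this
  exact two_ne_zero this

theorem specialize_one_one_sqrt : ∃ s : PowerSeries ℚ,
    IsSeriesSqrt s ((1 + PowerSeries.X) * (1 - 3 * PowerSeries.X)) ∧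
    toLaurent (specialize (1 : ℚ) 1 (walkSeries tandemSteps)) =
      toLaurent (1 - PowerSeries.X - s) / toLaurent (2 * PowerSeries.X ^ 2) := by
  have h := isSeriesSqrt_motzkinSeries (1 : ℚ) 1
  simp only [map_one, one_mul, one_pow] at h
  refine ⟨1 - PowerSeries.X - 2 * PowerSeries.X ^ 2 * motzkinSeries 1 1, ?_, ?_⟩
  · convert h using 1
    ring
  · rw [specialize_one_one]
    refine toLaurent_eq_div ?_ (by ring)
    exact mul_ne_zero two_ne_zero_powerSeries (pow_ne_zero _ PowerSeries.X_ne_zero)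


theorem specialize_inv_sqrt {K : Type*} [Field K] [Algebra ℚ K] [CharZero K] {x : K}
    (hx : x ≠ 0) : ∃ s : PowerSeries K,
    IsSeriesSqrt s (1 - 2 * PowerSeries.C x⁻¹ * PowerSeries.X
      + PowerSeries.X ^ 2 * PowerSeries.C x⁻¹ ^ 2 - 4 * PowerSeries.X ^ 2 * PowerSeries.C x) ∧
    toLaurent (specialize x x⁻¹ (walkSeries tandemSteps)) =
      toLaurent (1 - PowerSeries.X * PowerSeries.C x⁻¹ - s) /
        toLaurent (2 * PowerSeries.C x * PowerSeries.X ^ 2) := by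
  have h := isSeriesSqrt_motzkinSeries x⁻¹ (x ^ 3)
  have e : x ^ 3 * x⁻¹ ^ 2 = x := by field_simp
  rw [e] at h
  refine ⟨1 - PowerSeries.C x⁻¹ * PowerSeries.X
    - 2 * (PowerSeries.C x * PowerSeries.X ^ 2) * motzkinSeries x⁻¹ (x ^ 3), ?_, ?_⟩
  · convert h using 1
    ring
  · rw [specialize_inv hx]
    refine toLaurent_eq_div ?_ (by ring)
    refine mul_ne_zero (mul_ne_zero two_ne_zero_powerSeries ?_) (pow_ne_zero _ PowerSeries.X_ne_zero)
    rwa [Ne, map_eq_zero_iff _ PowerSeries.C_injective]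

open scoped Polynomial in
open Polynomial hiding toLaurent in
/-- `(1 - t / x) ^ 2 - 4 x t ^ 2` is not a square in `K(t)`. -/
theorem not_isSquare_discriminant {K : Type*} [Field K] [CharZero K] {x : K} (hx : x ≠ 0)
    (r : RatFunc K) :
    r ^ 2 ≠ algebraMap K[X] (RatFunc K) ((1 - C x⁻¹ * X) ^ 2 - 4 * C x * X ^ 2) := by
  intro h
  -- A rational square root of a polynomial is integral over $K[X]$, hence a polynomial, here of
  -- degree at most 1.
  have hint : IsIntegral K[X] r := by
    refine IsIntegral.of_pow (n := 2) (by norm_num) ?_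
    rw [h]
    exact isIntegral_algebraMap
  obtain ⟨p, rfl⟩ := IsIntegrallyClosed.isIntegral_iff.mp hint
  rw [← map_pow] at h
  have hp := IsFractionRing.injective K[X] (RatFunc K) h
  have hq : ((1 - C x⁻¹ * X) ^ 2 - 4 * C x * X ^ 2 : K[X]) =
      C (x⁻¹ ^ 2 - 4 * x) * X ^ 2 + C (-(2 * x⁻¹)) * X + C 1 := by
    simp only [map_sub, map_mul, map_pow, map_neg, map_one, map_ofNat]
    ring
  have hd : p.natDegree ≤ 1 := by
    have h1 := congrArg natDegree hp
    have h2 := natDegree_quadratic_le (a := x⁻¹ ^ 2 - 4 * x) (b := -(2 * x⁻¹)) (c := 1)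
    rw [natDegree_pow, hq] at h1
    omega
  rw [eq_X_add_C_of_natDegree_le_one hd] at hp
  generalize p.coeff 1 = b at hp
  generalize p.coeff 0 = a at hp
  have hs : (C b * X + C a) ^ 2 = C (b ^ 2) * X ^ 2 + C (2 * a * b) * X + C (a ^ 2) := by
    simp only [map_mul, map_pow, map_ofNat]
    ring
  rw [hs, hq] at hp
  have hc : ∀ u v w : K, (C u * X ^ 2 + C v * X + C w).coeff 0 = w ∧
      (C u * X ^ 2 + C v * X + C w).coeff 1 = v ∧ (C u * X ^ 2 + C v * X + C w).coeff 2 = u :=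
    fun u v w => by simp [coeff_X, coeff_C, coeff_X_pow]
  have c0 := congrArg (fun q => q.coeff 0) hp
  have c1 := congrArg (fun q => q.coeff 1) hp
  have c2 := congrArg (fun q => q.coeff 2) hp
  simp only [hc] at c0 c1 c2
  -- For a root $a+bX$, comparing coefficients gives $a^2=1$, $ab=-1/x$ and $b^2=x^{-2}-4x$, which
  -- together force $4x=0$.
  have h3 : (a * b) ^ 2 = x⁻¹ ^ 2 := by
    have : a * b = -x⁻¹ := by
      have h2 : (2 : K) ≠ 0 := two_ne_zero
      apply mul_left_cancel₀ h2
      linear_combination c1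
    rw [this, neg_sq]
  rw [mul_pow, c0, one_mul, c2] at h3
  have h4 : (4 : K) * x = 0 := by rw [inv_pow] at h3; linear_combination -h3
  exact hx (by simpa using h4)

theorem algebraMap_ratFunc_algebraMap {K : Type*} [Field K] (p : Polynomial K) :
    algebraMap (RatFunc K) (LaurentSeries K) (algebraMap (Polynomial K) (RatFunc K) p) =
      toLaurent (p : PowerSeries K) := by
  rw [← IsScalarTower.algebraMap_apply]
  rfl

open scoped Polynomial in
open Polynomial hiding toLaurent in
theorem aeval_toLaurent_motzkinSeries {K : Type*} [Field K] (a c : K) :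
    aeval (toLaurent (motzkinSeries a c))
      (C (algebraMap K[X] (RatFunc K) (C (c * a ^ 2) * X ^ 2)) * X ^ 2 -
        C (algebraMap K[X] (RatFunc K) (1 - C a * X)) * X + 1) = 0 := by
  have h := congrArg toLaurent (motzkinSeries_eq a c)
  simp only [toLaurent, map_add, map_mul, map_one, map_pow] at h
  simp only [map_add, map_sub, map_mul, map_pow, aeval_C, aeval_X, map_one,
    algebraMap_ratFunc_algebraMap, toLaurent, Polynomial.coe_C, Polynomial.coe_X]
  linear_combination -h

open scoped Polynomial in
open Polynomial hiding toLaurent in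
theorem isAlgebraic_toLaurent_motzkinSeries {K : Type*} [Field K] (a c : K) :
    IsAlgebraic (RatFunc K) (toLaurent (motzkinSeries a c)) := by
  refine ⟨_, fun h0 => ?_, aeval_toLaurent_motzkinSeries a c⟩
  have := congrArg (fun q => q.coeff 0) h0
  simp at this

open scoped Polynomial in
open Polynomial hiding toLaurent in
-- The quadratic equation bounds the degree by 2. Degree 1 would put the series in $K(t)$ and make
-- the discriminant a square there.
theorem natDegree_minpoly_motzkinSeries {K : Type*} [Field K] [CharZero K] {x : K}
    (hx : x ≠ 0) :
    (minpoly (RatFunc K) (toLaurent (motzkinSeries x⁻¹ (x ^ 3)))).natDegree = 2 := by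
  have e : x ^ 3 * x⁻¹ ^ 2 = x := by field_simp
  have halg := isAlgebraic_toLaurent_motzkinSeries x⁻¹ (x ^ 3)
  have hroot := aeval_toLaurent_motzkinSeries x⁻¹ (x ^ 3)
  have hle : (minpoly (RatFunc K) (toLaurent (motzkinSeries x⁻¹ (x ^ 3)))).natDegree ≤ 2 := by
    refine (natDegree_le_of_dvd (minpoly.dvd _ _ hroot) fun h0 => ?_).trans ?_
    · have := congrArg (fun q => q.coeff 0) h0
      simp at this
    · compute_degree
  have hpos := minpoly.natDegree_pos halg.isIntegral
  have hne : (minpoly (RatFunc K) (toLaurent (motzkinSeries x⁻¹ (x ^ 3)))).natDegree ≠ 1 := by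
    intro h1
    obtain ⟨r, hr⟩ := (minpoly.natDegree_eq_one_iff).mp h1
    have hsq := (isSeriesSqrt_motzkinSeries x⁻¹ (x ^ 3)).1
    rw [e] at hsq
    have := congrArg toLaurent hsq
    apply not_isSquare_discriminant hx (algebraMap K[X] (RatFunc K) (1 - C x⁻¹ * X)
      - 2 * algebraMap K[X] (RatFunc K) (C x * X ^ 2) * r)
    apply (algebraMap (RatFunc K) (LaurentSeries K)).injective
    rw [map_pow, map_sub, map_mul, map_mul, hr, map_ofNat]
    simp only [algebraMap_ratFunc_algebraMap, toLaurent, Polynomial.coe_C, Polynomial.coe_X, map_sub, map_mul,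
      map_pow, map_one, map_ofNat] at this ⊢
    rw [this]
    ring
  omega

theorem specialize_ratFunc_inv_degree :
    IsAlgebraic (RatFunc (RatFunc ℚ)) (toLaurent
      (specialize (RatFunc.X : RatFunc ℚ) (RatFunc.X)⁻¹ (walkSeries tandemSteps))) ∧
    (minpoly (RatFunc (RatFunc ℚ)) (toLaurent
      (specialize (RatFunc.X : RatFunc ℚ) (RatFunc.X)⁻¹ (walkSeries tandemSteps)))).natDegree
        = 2 := by
  rw [specialize_inv RatFunc.X_ne_zero]
  exact ⟨isAlgebraic_toLaurent_motzkinSeries _ _,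
    natDegree_minpoly_motzkinSeries RatFunc.X_ne_zero⟩

end MotzkinSeries

/-! ### Asymptotics of the number of walks that end at the origin -/

section Asymptotics

open Filter Asymptotics Topology

theorem cast_walkCount_origin (m : ℕ) :
    (walkCount tandemSteps 0 0 (3 * m) : ℝ) =
      2 * (3 * m).factorial / ((m.factorial : ℝ) ^ 3 * ((m + 1) ^ 2 * (m + 2))) := by
  have h := congrArg (Rat.cast : ℚ → ℝ) (walkCount_origin m)
  push_cast at h
  rw [h, Nat.factorial_succ (m + 1), Nat.factorial_succ m]
  have h1 : (m.factorial : ℝ) ≠ 0 := by exact_mod_cast Nat.factorial_ne_zero m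
  push_cast
  field_simp
  ring

theorem natCast_add_isEquivalent (c : ℝ) :
    (fun m : ℕ => (m : ℝ) + c) ~[atTop] fun m : ℕ => (m : ℝ) := by
  refine IsEquivalent.add_isLittleO IsEquivalent.refl ?_
  rw [isLittleO_const_left]
  exact Or.inr (tendsto_norm_atTop_atTop.comp tendsto_natCast_atTop_atTop)

theorem walkCount_origin_isEquivalent :
    IsEquivalent atTop (fun m : ℕ => (walkCount tandemSteps 0 0 (3 * m) : ℝ))
      (fun m : ℕ => √3 * ((3 : ℝ) ^ (3 * m) / (Real.pi * (m : ℝ) ^ 4))) := by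
  have hst := Stirling.factorial_isEquivalent_stirling
  have h3 := hst.comp_tendsto (tendsto_id.const_mul_atTop' (by norm_num : 0 < 3))
  have hnum := (IsEquivalent.refl (u := fun _ : ℕ => (2 : ℝ)) (l := atTop)).mul h3
  have hden := (hst.pow 3).mul
    (((natCast_add_isEquivalent 1).pow 2).mul (natCast_add_isEquivalent 2))
  have h := hnum.div hden
  refine (h.congr_left ?_).congr_right ?_
  · refine Eventually.of_forall fun m => ?_
    simp only [id]
    rw [cast_walkCount_origin]
    simp
  · filter_upwards [eventually_gt_atTop 0] with m hm
    have hm' : (0 : ℝ) < m := by exact_mod_cast hm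
    simp only [Function.comp, id, Pi.mul_apply, Pi.div_apply, Pi.pow_apply]
    -- The exponential parts of Stirling's formula leave $3^{3m}$, and the square roots leave
    -- $\sqrt{6\pi m}/(2\pi m)^{3/2}=\sqrt3/(2\pi m)$.
    have e1 : √(2 * ((3 * m : ℕ) : ℝ) * Real.pi) = √3 * √(2 * m * Real.pi) := by
      rw [← Real.sqrt_mul (by norm_num)]
      congr 1
      push_cast
      ring
    have e2 : √(2 * m * Real.pi) ^ 2 = 2 * m * Real.pi := Real.sq_sqrt (by positivity)
    have e3 : (((3 * m : ℕ) : ℝ) / Real.exp 1) ^ (3 * m) =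
        3 ^ (3 * m) * (((m : ℝ) / Real.exp 1) ^ m) ^ 3 := by
      push_cast
      rw [mul_div_assoc, mul_pow, ← pow_mul, mul_comm m 3]
    have e4 : 0 < √(2 * m * Real.pi) := by positivity
    have e5 : 0 < ((m : ℝ) / Real.exp 1) ^ m := by positivity
    rw [e1, e3, mul_pow, pow_succ (√(2 * m * Real.pi)) 2, e2]
    generalize √(2 * m * Real.pi) = s at e4
    generalize ((m : ℝ) / Real.exp 1) ^ m = t at e5
    have := Real.pi_pos
    field_simp

end Asymptotics

/-! ### Transcendence of the series of walks that end at the origin -/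

section Transcendence

open Filter Topology

/-! #### Derivatives of algebraic power series -/

/-- By the Leibniz rule; $Q$ is $P$ with its coefficients differentiated. -/
theorem exists_derivative_aeval (F : PowerSeries ℚ) (P : Polynomial (Polynomial ℚ)) :
    ∃ Q : Polynomial (Polynomial ℚ), PowerSeries.derivative ℚ (Polynomial.aeval F P) =
      Polynomial.aeval F Q +
        Polynomial.aeval F (Polynomial.derivative P) * PowerSeries.derivative ℚ F := by
  induction P using Polynomial.induction_on' with
  | add P₁ P₂ h₁ h₂ =>
    obtain ⟨Q₁, h₁⟩ := h₁
    obtain ⟨Q₂, h₂⟩ := h₂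
    refine ⟨Q₁ + Q₂, ?_⟩
    simp only [map_add, h₁, h₂]
    ring
  | monomial k p =>
    refine ⟨Polynomial.monomial k (Polynomial.derivative p), ?_⟩
    have hp : algebraMap (Polynomial ℚ) (PowerSeries ℚ) p = (p : PowerSeries ℚ) := rfl
    have hp' : algebraMap (Polynomial ℚ) (PowerSeries ℚ) (Polynomial.derivative p) =
      (Polynomial.derivative p : PowerSeries ℚ) := rfl
    rw [Polynomial.derivative_monomial, Polynomial.aeval_monomial, Polynomial.aeval_monomial,
      Polynomial.aeval_monomial, map_mul (algebraMap _ _), map_natCast (algebraMap _ _), hp, hp',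
      Derivation.leibniz, Derivation.leibniz_pow, PowerSeries.derivative_coe]
    simp only [smul_eq_mul, nsmul_eq_mul]
    ring

theorem isAlgebraic_aeval {R S : Type*} [CommRing R] [IsDomain R] [CommRing S] [Algebra R S]
    {x : S} (hx : IsAlgebraic R x) (P : Polynomial R) : IsAlgebraic R (Polynomial.aeval x P) :=
  Algebra.isAlgebraic_adjoin_singleton_iff.mpr hx _ (Polynomial.aeval_mem_adjoin_singleton R x)

/-- Let $P$ have least degree among the nonzero polynomials with $P(F)=0$. Differentiation gives
$P'(F)\,F'=-Q(F)$, and $P'(F)\ne0$ by minimality. -/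
theorem isAlgebraic_derivative {F : PowerSeries ℚ} (hF : IsAlgebraic (Polynomial ℚ) F) :
    IsAlgebraic (Polynomial ℚ) (PowerSeries.derivative ℚ F) := by
  classical
  have hex : ∃ d, ∃ P : Polynomial (Polynomial ℚ), P ≠ 0 ∧ Polynomial.aeval F P = 0 ∧
      P.natDegree = d := by
    obtain ⟨P, h1, h2⟩ := hF
    exact ⟨_, P, h1, h2, rfl⟩
  obtain ⟨P, hP0, hP, hd⟩ := Nat.find_spec hex
  have hmin : ∀ Q : Polynomial (Polynomial ℚ), Q ≠ 0 → Q.natDegree < P.natDegree →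
      Polynomial.aeval F Q ≠ 0 := by
    intro Q hQ hlt h
    exact Nat.find_min hex (hd ▸ hlt) ⟨Q, hQ, h, rfl⟩
  have hpos : P.natDegree ≠ 0 := by
    intro h
    rw [Polynomial.eq_C_of_natDegree_eq_zero h, Polynomial.aeval_C] at hP
    have : P.coeff 0 = 0 := Polynomial.coe_injective ℚ (hP.trans Polynomial.coe_zero.symm)
    rw [Polynomial.eq_C_of_natDegree_eq_zero h, this, map_zero] at hP0
    exact hP0 rfl
  have hd0 : Polynomial.derivative P ≠ 0 := by
    intro h
    exact hpos (Polynomial.derivative_eq_zero.mp h)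
  have hne := hmin _ hd0 (Polynomial.natDegree_derivative_lt hpos)
  obtain ⟨Q, hQ⟩ := exists_derivative_aeval F P
  rw [hP, map_zero] at hQ
  refine IsAlgebraic.of_mul (mem_nonZeroDivisors_of_ne_zero hne) (isAlgebraic_aeval hF _) ?_
  rw [← neg_eq_of_add_eq_zero_right hQ.symm]
  exact (isAlgebraic_aeval hF Q).neg

/-- The operator `t d/dt`. -/
noncomputable def eulerOp (F : PowerSeries ℚ) : PowerSeries ℚ :=
  PowerSeries.X * PowerSeries.derivative ℚ F

theorem coeff_eulerOp (F : PowerSeries ℚ) (n : ℕ) :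
    PowerSeries.coeff n (eulerOp F) = n * PowerSeries.coeff n F := by
  rcases n with _ | n
  · simp [eulerOp]
  · rw [eulerOp, PowerSeries.coeff_succ_X_mul, PowerSeries.coeff_derivative]
    push_cast
    ring

theorem isAlgebraic_eulerOp {F : PowerSeries ℚ} (hF : IsAlgebraic (Polynomial ℚ) F) :
    IsAlgebraic (Polynomial ℚ) (eulerOp F) := by
  refine IsAlgebraic.mul ?_ (isAlgebraic_derivative hF)
  have : (PowerSeries.X : PowerSeries ℚ) = algebraMap (Polynomial ℚ) _ Polynomial.X := by
    change _ = ((Polynomial.X : Polynomial ℚ) : PowerSeries ℚ)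
    rw [Polynomial.coe_X]
  rw [this]
  exact isAlgebraic_algebraMap _

/-! #### Evaluation of absolutely convergent power series -/

/-- The power series `F` converges absolutely at `r`, with sum `v`. -/
def HasEval (F : PowerSeries ℚ) (r v : ℝ) : Prop :=
  (Summable fun n => ‖((PowerSeries.coeff n F : ℚ) : ℝ) * r ^ n‖) ∧
    HasSum (fun n => ((PowerSeries.coeff n F : ℚ) : ℝ) * r ^ n) v

theorem HasEval.unique {F : PowerSeries ℚ} {r v w : ℝ} (h : HasEval F r v) (h' : HasEval F r w) :
    v = w := h.2.unique h'.2

theorem HasEval.add {F G : PowerSeries ℚ} {r v w : ℝ} (hF : HasEval F r v) (hG : HasEval G r w) :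
    HasEval (F + G) r (v + w) := by
  have e : ∀ n, ((PowerSeries.coeff n (F + G) : ℚ) : ℝ) * r ^ n =
      ((PowerSeries.coeff n F : ℚ) : ℝ) * r ^ n + ((PowerSeries.coeff n G : ℚ) : ℝ) * r ^ n := by
    intro n; rw [map_add]; push_cast; ring
  refine ⟨?_, ?_⟩
  · refine Summable.of_nonneg_of_le (fun n => norm_nonneg _) (fun n => ?_) (hF.1.add hG.1)
    rw [e]
    exact norm_add_le _ _
  · simp only [e]
    exact hF.2.add hG.2

/-- Absolute convergence, part of `HasEval`, is what lets the Cauchy product sum to the product of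
the values. -/
theorem HasEval.mul {F G : PowerSeries ℚ} {r v w : ℝ} (hF : HasEval F r v) (hG : HasEval G r w) :
    HasEval (F * G) r (v * w) := by
  have e : ∀ n, ((PowerSeries.coeff n (F * G) : ℚ) : ℝ) * r ^ n =
      ∑ p ∈ Finset.HasAntidiagonal.antidiagonal n, (((PowerSeries.coeff p.1 F : ℚ) : ℝ) * r ^ p.1) *
        (((PowerSeries.coeff p.2 G : ℚ) : ℝ) * r ^ p.2) := by
    intro n
    rw [PowerSeries.coeff_mul]
    push_cast
    rw [Finset.sum_mul]
    refine Finset.sum_congr rfl fun p hp => ?_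
    rw [← Finset.HasAntidiagonal.mem_antidiagonal.mp hp]
    ring
  have hs := summable_norm_sum_mul_antidiagonal_of_summable_norm hF.1 hG.1
  refine ⟨?_, ?_⟩
  · simp only [e]
    exact hs
  · simp only [e]
    rw [← hF.2.tsum_eq, ← hG.2.tsum_eq,
      tsum_mul_tsum_eq_tsum_sum_antidiagonal_of_summable_norm hF.1 hG.1]
    exact hs.of_norm.hasSum

theorem hasEval_coe (p : Polynomial ℚ) (r : ℝ) :
    HasEval (p : PowerSeries ℚ) r (p.eval₂ (algebraMap ℚ ℝ) r) := by
  have h0 : ∀ n ∉ Finset.range (p.natDegree + 1),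
      ((PowerSeries.coeff n (p : PowerSeries ℚ) : ℚ) : ℝ) * r ^ n = 0 := by
    intro n hn
    rw [Polynomial.coeff_coe, Polynomial.coeff_eq_zero_of_natDegree_lt]
    · simp
    · simpa using hn
  refine ⟨summable_of_ne_finset_zero (s := Finset.range (p.natDegree + 1)) fun n hn => ?_, ?_⟩
  · rw [h0 n hn, norm_zero]
  · rw [Polynomial.eval₂_eq_sum_range]
    have h : HasSum (fun n => ((PowerSeries.coeff n (p : PowerSeries ℚ) : ℚ) : ℝ) * r ^ n)
        (∑ n ∈ Finset.range (p.natDegree + 1),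
          ((PowerSeries.coeff n (p : PowerSeries ℚ) : ℚ) : ℝ) * r ^ n) :=
      hasSum_sum_of_ne_finset_zero h0
    simpa using h

theorem HasEval.pow {F : PowerSeries ℚ} {r v : ℝ} (hF : HasEval F r v) (k : ℕ) :
    HasEval (F ^ k) r (v ^ k) := by
  induction k with
  | zero => simpa using hasEval_coe 1 r
  | succ k ih => rw [pow_succ, pow_succ]; exact ih.mul hF

theorem HasEval.aeval {F : PowerSeries ℚ} {r v : ℝ} (hF : HasEval F r v)
    (P : Polynomial (Polynomial ℚ)) : HasEval (Polynomial.aeval F P) r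
      (P.eval₂ (Polynomial.eval₂RingHom (algebraMap ℚ ℝ) r) v) := by
  induction P using Polynomial.induction_on' with
  | add P₁ P₂ h₁ h₂ =>
    rw [map_add, Polynomial.eval₂_add]
    exact h₁.add h₂
  | monomial k p =>
    rw [Polynomial.aeval_monomial, Polynomial.eval₂_monomial]
    exact (hasEval_coe p r).mul (hF.pow k)

/-! #### Algebraic functions do not grow like logarithms -/

/-- If `v` tends to infinity and `(r - r₀) v ^ j` tends to `0` for all `j`, then `v` satisfies no
nontrivial polynomial equation over the polynomials in `r`. -/
theorem not_algebraic_of_log_growth {ι : Type*} {l : Filter ι} [l.NeBot] {r v : ι → ℝ} {r₀ : ℝ}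
    (hr : Tendsto r l (𝓝 r₀)) (hv : Tendsto v l atTop)
    (hrv : ∀ j : ℕ, Tendsto (fun i => (r i - r₀) * v i ^ j) l (𝓝 0))
    (p : ℕ → Polynomial ℝ) (N : ℕ) (hp : ∃ k < N, (p k).eval r₀ ≠ 0)
    (h : ∀ᶠ i in l, ∑ k ∈ Finset.range N, (p k).eval (r i) * v i ^ k = 0) : False := by
  classical
  -- Let $K$ be the largest index with $p_K(r_0)\ne0$ and divide the equation by $v^K$. Lower terms
  -- vanish because $v\to\infty$. Higher terms vanish because $r-r_0$ divides $p_k$. The limit is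
  -- then $p_K(r_0)\neq0$, a contradiction.
  set s := (Finset.range N).filter fun k => (p k).eval r₀ ≠ 0 with hs
  have hne : s.Nonempty := by
    obtain ⟨k, hk, hk'⟩ := hp
    exact ⟨k, by simp [hs, hk, hk']⟩
  set K := s.max' hne with hK
  have hKs : K ∈ s := s.max'_mem hne
  have hmax : ∀ k < N, K < k → (p k).eval r₀ = 0 := by
    intro k hk hlt
    by_contra hk'
    exact absurd (s.le_max' k (by simp [hs, hk, hk'])) (not_le.mpr hlt)
  have hlim : ∀ k ∈ Finset.range N, Tendsto (fun i => (p k).eval (r i) * v i ^ k / v i ^ K) l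
      (𝓝 (if k = K then (p K).eval r₀ else 0)) := by
    intro k hk
    have hpk : Tendsto (fun i => (p k).eval (r i)) l (𝓝 ((p k).eval r₀)) :=
      ((p k).continuous.tendsto r₀).comp hr
    rcases lt_trichotomy k K with hlt | rfl | hlt
    · rw [if_neg hlt.ne]
      have h1 : Tendsto (fun i => (v i ^ (K - k))⁻¹) l (𝓝 0) :=
        tendsto_inv_atTop_zero.comp ((tendsto_pow_atTop (by omega)).comp hv)
      have h2 := hpk.mul h1
      rw [mul_zero] at h2
      refine h2.congr' ?_
      filter_upwards [hv.eventually_gt_atTop 0] with i hi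
      rw [show v i ^ K = v i ^ (K - k) * v i ^ k by rw [← pow_add]; congr 1; omega]
      field_simp
    · rw [if_pos rfl]
      refine hpk.congr' ?_
      filter_upwards [hv.eventually_gt_atTop 0] with i hi
      field_simp
    · rw [if_neg hlt.ne']
      obtain ⟨q, hq⟩ := Polynomial.dvd_iff_isRoot.mpr (hmax k (Finset.mem_range.mp hk) hlt)
      have h1 : Tendsto (fun i => q.eval (r i)) l (𝓝 (q.eval r₀)) :=
        (q.continuous.tendsto r₀).comp hr
      have h2 := h1.mul (hrv (k - K))
      rw [mul_zero] at h2
      refine h2.congr' ?_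
      filter_upwards [hv.eventually_gt_atTop 0] with i hi
      rw [hq, Polynomial.eval_mul, Polynomial.eval_sub, Polynomial.eval_X, Polynomial.eval_C,
        show v i ^ k = v i ^ (k - K) * v i ^ K by rw [← pow_add]; congr 1; omega]
      field_simp
  have hsum := tendsto_finsetSum _ hlim
  rw [Finset.sum_ite_eq' _ K, if_pos (Finset.mem_filter.mp hKs).1] at hsum
  have hzero : Tendsto (fun i => ∑ k ∈ Finset.range N, (p k).eval (r i) * v i ^ k / v i ^ K) l
      (𝓝 0) := by
    refine tendsto_const_nhds.congr' ?_
    filter_upwards [h] with i hi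
    rw [← Finset.sum_div, hi, zero_div]
  exact (Finset.mem_filter.mp hKs).2 (tendsto_nhds_unique hsum hzero)

/-- A power series with values of logarithmic growth at a rational point is transcendental. -/
theorem transcendental_of_log_growth {F : PowerSeries ℚ} {ι : Type*} {l : Filter ι} [l.NeBot]
    {r v : ι → ℝ} {r₀ : ℚ} (hF : ∀ᶠ i in l, HasEval F (r i) (v i))
    (hr : Tendsto r l (𝓝 r₀)) (hv : Tendsto v l atTop)
    (hrv : ∀ j : ℕ, Tendsto (fun i => (r i - r₀) * v i ^ j) l (𝓝 0)) :
    Transcendental (Polynomial ℚ) F := by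
  rintro ⟨P, hP0, hP⟩
  let _ : NormalizedGCDMonoid (Polynomial ℚ) :=
    UniqueFactorizationMonoid.toNormalizedGCDMonoid (Polynomial ℚ)
  have : FaithfulSMul (Polynomial ℚ) (PowerSeries ℚ) :=
    (faithfulSMul_iff_algebraMap_injective _ _).mpr (Polynomial.coe_injective ℚ)
  -- Passing to the primitive part ensures that some coefficient does not vanish at $r_0$; otherwise
  -- $X-r_0$ would divide all of them.
  have hPF := Polynomial.aeval_primPart_eq_zero hP0 hP
  have hprim := P.isPrimitive_primPart
  generalize P.primPart = Q at hPF hprim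
  refine not_algebraic_of_log_growth hr hv hrv
    (fun k => (Q.coeff k).map (algebraMap ℚ ℝ)) (Q.natDegree + 1) ?_ ?_
  · by_contra! hcon
    have hdvd : Polynomial.C (Polynomial.X - Polynomial.C r₀) ∣ Q := by
      rw [Polynomial.C_dvd_iff_dvd_coeff]
      intro k
      rw [Polynomial.dvd_iff_isRoot, Polynomial.IsRoot.def]
      rcases lt_or_ge k (Q.natDegree + 1) with hk | hk
      · have := hcon k hk
        rw [Polynomial.eval_map, ← eq_ratCast (algebraMap ℚ ℝ), Polynomial.eval₂_at_apply] at this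
        simpa using this
      · rw [Polynomial.coeff_eq_zero_of_natDegree_lt (by omega), Polynomial.eval_zero]
    exact Polynomial.not_isUnit_X_sub_C r₀ (hprim _ hdvd)
  · filter_upwards [hF] with i hi
    have h1 := (hi.aeval Q)
    rw [hPF] at h1
    have h2 : HasEval (0 : PowerSeries ℚ) (r i) 0 := by simpa using hasEval_coe 0 (r i)
    have h3 := h1.unique h2
    rw [Polynomial.eval₂_eq_sum_range] at h3
    simpa only [Polynomial.eval_map, Polynomial.coe_eval₂RingHom] using h3

/-! #### The excursion series -/

theorem coeff_specialize_zero_zero (n : ℕ) :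
    PowerSeries.coeff n (specialize (0 : ℚ) 0 (walkSeries tandemSteps)) =
      walkCount tandemSteps 0 0 n := by
  rw [specialize_walkSeries, ← sum_quadrantWalks_ite_eq]
  refine Finset.sum_congr rfl fun w hw => ?_
  have := quadrantWalks_end_nonneg hw
  split_ifs with h
  · simp [h]
  · rw [Prod.ext_iff] at h
    have h' : (walkPos w n).1.toNat ≠ 0 ∨ (walkPos w n).2.toNat ≠ 0 := by
      simp only [Nat.cast_zero] at h
      omega
    rcases h' with h' | h' <;> simp [h']

/-- The numbers `m ^ 4 * q(0, 0; 3 m) / 27 ^ m` are bounded above and away from zero. -/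
theorem exists_bounds_walkCount_origin : ∃ c C : ℝ, 0 < c ∧ 0 < C ∧ ∀ m : ℕ, 0 < m →
    c / m ≤ (3 * m : ℝ) ^ 3 * walkCount tandemSteps 0 0 (3 * m) / 3 ^ (3 * m) ∧
    (3 * m : ℝ) ^ 3 * walkCount tandemSteps 0 0 (3 * m) / 3 ^ (3 * m) ≤ C / m := by
  set u : ℕ → ℝ := fun m =>
    (3 * m : ℝ) ^ 3 * walkCount tandemSteps 0 0 (3 * m) / 3 ^ (3 * m) * m with hu
  have hpos : ∀ m, 0 < m → 0 < u m := by
    intro m hm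
    have hm' : (0 : ℝ) < m := by exact_mod_cast hm
    rw [hu]
    simp only
    rw [cast_walkCount_origin]
    positivity
  have hL : 0 < 27 * √3 / Real.pi := by positivity
  have hlim : Tendsto u atTop (𝓝 (27 * √3 / Real.pi)) := by
    have h1 : ∀ᶠ m : ℕ in atTop,
        √3 * ((3 : ℝ) ^ (3 * m) / (Real.pi * (m : ℝ) ^ 4)) ≠ 0 := by
      filter_upwards [eventually_gt_atTop 0] with m hm
      have hm' : (0 : ℝ) < m := by exact_mod_cast hm
      positivity
    have h2 := ((Asymptotics.isEquivalent_iff_tendsto_one h1).mp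
      walkCount_origin_isEquivalent).const_mul (27 * √3 / Real.pi)
    rw [mul_one] at h2
    refine h2.congr' ?_
    filter_upwards [eventually_gt_atTop 0] with m hm
    have hm' : (0 : ℝ) < m := by exact_mod_cast hm
    simp only [Pi.div_apply, hu]
    field_simp
    ring
  -- The limit is nonzero, so $u$ and $u^{-1}$ both converge and are bounded; the bound on $u^{-1}$
  -- gives the lower constant.
  obtain ⟨C, hC⟩ := hlim.bddAbove_range
  obtain ⟨D, hD⟩ := (hlim.inv₀ hL.ne').bddAbove_range
  have hC' : ∀ m, u m ≤ C := fun m => hC ⟨m, rfl⟩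
  have hD' : ∀ m, (u m)⁻¹ ≤ D := fun m => hD ⟨m, rfl⟩
  have hC0 : 0 < C := (hpos 1 one_pos).trans_le (hC' 1)
  have hD0 : 0 < D := (inv_pos.mpr (hpos 1 one_pos)).trans_le (hD' 1)
  refine ⟨D⁻¹, C, inv_pos.mpr hD0, hC0, fun m hm => ?_⟩
  have hm' : (0 : ℝ) < m := by exact_mod_cast hm
  rw [div_le_iff₀ hm', le_div_iff₀ hm']
  exact ⟨inv_le_of_inv_le₀ (hpos m hm) (hD' m), hC' m⟩

/-- The third derivative of the excursion series grows like a logarithm at its singularity. -/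
theorem exists_hasEval_excursions : ∃ c C : ℝ, 0 < c ∧ 0 < C ∧ ∃ v : ℝ → ℝ,
    ∀ ρ ∈ Set.Ioo (0 : ℝ) 1,
      HasEval (eulerOp (eulerOp (eulerOp (specialize (0 : ℚ) 0 (walkSeries tandemSteps)))))
        (ρ / 3) (v ρ) ∧
      c * -Real.log (1 - ρ ^ 3) ≤ v ρ ∧ v ρ ≤ C * -Real.log (1 - ρ ^ 3) := by
  obtain ⟨c, C, hc, hC, hb⟩ := exists_bounds_walkCount_origin
  set h : ℕ → ℝ := fun m =>
    (3 * m : ℝ) ^ 3 * walkCount tandemSteps 0 0 (3 * m) / 3 ^ (3 * m) with hh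
  have h0 : h 0 = 0 := by simp [hh]
  have hnn : ∀ m, 0 ≤ h m := fun m => by simp only [hh]; positivity
  -- At $t=\rho/3$ only lengths $3m$ contribute. Three Euler operators supply the factor $(3m)^3$,
  -- and the sum is compared with $-\log(1-\rho^3)=\sum_{m\ge1}\rho^{3m}/m$.
  refine ⟨c, C, hc, hC, fun ρ => ∑' m, h m * (ρ ^ 3) ^ m, fun ρ hρ => ?_⟩
  obtain ⟨hρ0, hρ1⟩ := hρ
  have hρ3 : ρ ^ 3 < 1 := pow_lt_one₀ hρ0.le hρ1 (by norm_num)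
  have hlog := Real.hasSum_pow_div_log_of_abs_lt_one
    (x := ρ ^ 3) (by rw [abs_of_nonneg (by positivity)]; exact hρ3)
  have hle : ∀ m, h (m + 1) * (ρ ^ 3) ^ (m + 1) ≤ C * ((ρ ^ 3) ^ (m + 1) / ((m : ℝ) + 1)) := by
    intro m
    have h1 := (hb (m + 1) (by omega)).2
    push_cast at h1
    calc h (m + 1) * (ρ ^ 3) ^ (m + 1) ≤ C / ((m : ℝ) + 1) * (ρ ^ 3) ^ (m + 1) := by
          refine mul_le_mul_of_nonneg_right ?_ (by positivity)
          simp only [hh]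
          push_cast
          exact h1
      _ = _ := by ring
  have hge : ∀ m : ℕ, c * ((ρ ^ 3) ^ (m + 1) / ((m : ℝ) + 1)) ≤ h (m + 1) * (ρ ^ 3) ^ (m + 1) := by
    intro m
    have h1 := (hb (m + 1) (by omega)).1
    push_cast at h1
    calc _ = c / ((m : ℝ) + 1) * (ρ ^ 3) ^ (m + 1) := by ring
      _ ≤ h (m + 1) * (ρ ^ 3) ^ (m + 1) := by
          refine mul_le_mul_of_nonneg_right ?_ (by positivity)
          simp only [hh]
          push_cast
          exact h1
  have hs1 : Summable fun m => h (m + 1) * (ρ ^ 3) ^ (m + 1) :=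
    Summable.of_nonneg_of_le (fun m => mul_nonneg (hnn _) (by positivity)) hle
      (hlog.summable.mul_left C)
  have hs : Summable fun m => h m * (ρ ^ 3) ^ m := (summable_nat_add_iff 1).mp hs1
  have hv : ∑' m, h m * (ρ ^ 3) ^ m = ∑' m, h (m + 1) * (ρ ^ 3) ^ (m + 1) := by
    rw [hs.tsum_eq_zero_add, h0, zero_mul, zero_add]
  have hinj : Function.Injective fun m : ℕ => 3 * m := fun a b hab => by
    simpa using hab
  have hterm : ∀ m, ((PowerSeries.coeff (3 * m) (eulerOp (eulerOp (eulerOp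
      (specialize (0 : ℚ) 0 (walkSeries tandemSteps))))) : ℚ) : ℝ) * (ρ / 3) ^ (3 * m) =
      h m * (ρ ^ 3) ^ m := by
    intro m
    simp only [coeff_eulerOp, coeff_specialize_zero_zero, hh]
    push_cast
    rw [div_pow, ← pow_mul]
    field_simp
  have hzero : ∀ n ∉ Set.range fun m : ℕ => 3 * m, ((PowerSeries.coeff n
      (eulerOp (eulerOp (eulerOp (specialize (0 : ℚ) 0 (walkSeries tandemSteps))))) : ℚ) : ℝ)
        * (ρ / 3) ^ n = 0 := by
    intro n hn
    have : walkCount tandemSteps 0 0 n = 0 := by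
      refine walkCount_eq_zero fun m hm => hn ⟨m, ?_⟩
      simp only
      omega
    simp [coeff_eulerOp, coeff_specialize_zero_zero, this]
  have hsum : HasSum (fun n => ((PowerSeries.coeff n (eulerOp (eulerOp (eulerOp
      (specialize (0 : ℚ) 0 (walkSeries tandemSteps))))) : ℚ) : ℝ) * (ρ / 3) ^ n)
      (∑' m, h m * (ρ ^ 3) ^ m) := by
    rw [← hinj.hasSum_iff hzero]
    convert hs.hasSum using 1
    exact funext hterm
  refine ⟨⟨hsum.summable.norm, hsum⟩, ?_, ?_⟩
  · simp only [hv]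
    rw [← hlog.tsum_eq, ← tsum_mul_left]
    exact (hlog.summable.mul_left c).tsum_le_tsum hge hs1
  · simp only [hv]
    rw [← hlog.tsum_eq, ← tsum_mul_left]
    exact hs1.tsum_le_tsum hle (hlog.summable.mul_left C)

theorem transcendental_excursions :
    Transcendental (Polynomial ℚ) (specialize (0 : ℚ) 0 (walkSeries tandemSteps)) := by
  intro halg
  obtain ⟨c, C, hc, hC, v, hv⟩ := exists_hasEval_excursions
  have hIoo : ∀ᶠ ρ : ℝ in 𝓝[<] 1, ρ ∈ Set.Ioo (0 : ℝ) 1 :=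
    Ioo_mem_nhdsLT (by norm_num)
  have hid : Tendsto (fun ρ : ℝ => ρ) (𝓝[<] 1) (𝓝 1) := tendsto_id'.mpr nhdsWithin_le_nhds
  have hy : Tendsto (fun ρ : ℝ => (1 - ρ ^ 3)⁻¹) (𝓝[<] 1) atTop := by
    refine tendsto_inv_nhdsGT_zero.comp (tendsto_nhdsWithin_iff.mpr ⟨?_, ?_⟩)
    · have := (hid.pow 3).const_sub 1
      simpa using this
    · filter_upwards [hIoo] with ρ hρ
      exact sub_pos.mpr (pow_lt_one₀ hρ.1.le hρ.2 (by norm_num))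
  have hlog : ∀ ρ : ℝ, -Real.log (1 - ρ ^ 3) = Real.log (1 - ρ ^ 3)⁻¹ := fun ρ => by
    rw [Real.log_inv]
  refine transcendental_of_log_growth (l := 𝓝[<] (1 : ℝ)) (r := fun ρ => ρ / 3) (v := v)
    (r₀ := 1 / 3) ?_ ?_ ?_ ?_ (isAlgebraic_eulerOp (isAlgebraic_eulerOp (isAlgebraic_eulerOp halg)))
  · filter_upwards [hIoo] with ρ hρ using (hv ρ hρ).1
  · have := hid.div_const 3
    simpa using this
  · refine tendsto_atTop_mono' _ ?_ ((Real.tendsto_log_atTop.comp hy).const_mul_atTop hc)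
    filter_upwards [hIoo] with ρ hρ
    have := (hv ρ hρ).2.1
    rwa [hlog] at this
  · intro j
    have h1 := ((Real.isLittleO_pow_log_id_atTop (n := j)).comp_tendsto hy).tendsto_div_nhds_zero
    have h2 := h1.const_mul (C ^ j)
    rw [mul_zero] at h2
    refine squeeze_zero_norm' ?_ h2
    filter_upwards [hIoo] with ρ hρ
    obtain ⟨-, hlo, hhi⟩ := hv ρ hρ
    have hρ3 : ρ ^ 3 < 1 := pow_lt_one₀ hρ.1.le hρ.2 (by norm_num)
    have hρ3' : ρ ^ 3 ≤ ρ := by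
      have := pow_le_pow_of_le_one hρ.1.le hρ.2.le (show 1 ≤ 3 by norm_num)
      simpa using this
    have hlog0 : 0 ≤ -Real.log (1 - ρ ^ 3) := by
      rw [neg_nonneg]
      refine Real.log_nonpos (by linarith) ?_
      have : 0 ≤ ρ ^ 3 := pow_nonneg hρ.1.le 3
      linarith
    have hv0 : 0 ≤ v ρ := (mul_nonneg hc.le hlog0).trans hlo
    rw [hlog] at hhi
    have h3 : v ρ ^ j ≤ (C * Real.log (1 - ρ ^ 3)⁻¹) ^ j := pow_le_pow_left₀ hv0 hhi j
    -- The distance to the singularity is $(1-\rho)/3\le1-\rho^3$, and this linear factor beats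
    -- every power of the logarithm.
    have h4 : |ρ / 3 - ((1 / 3 : ℚ) : ℝ)| ≤ 1 - ρ ^ 3 := by
      push_cast
      rw [abs_le]
      constructor <;> linarith [hρ.1, hρ.2]
    simp only [Function.comp, id, Real.norm_eq_abs, abs_mul, div_inv_eq_mul]
    rw [abs_of_nonneg (pow_nonneg hv0 j), mul_comm _ (1 - ρ ^ 3), ← mul_assoc,
      mul_comm (C ^ j), mul_assoc, ← mul_pow]
    exact mul_le_mul h4 h3 (pow_nonneg hv0 j) (by linarith)

end Transcendence

/-! ### Series in three variables and transcendence of `Q(x, y; t)` -/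

section ThreeVar

/-- The exponent of `x ^ i * y ^ j * t ^ n`. -/
noncomputable def expo (i j n : ℕ) : Fin 3 →₀ ℕ := Finsupp.equivFunOnFinite.symm ![i, j, n]

theorem expo_zero (i j n : ℕ) : expo i j n 0 = i := rfl
theorem expo_one (i j n : ℕ) : expo i j n 1 = j := rfl
theorem expo_two (i j n : ℕ) : expo i j n 2 = n := rfl

theorem expo_self (e : Fin 3 →₀ ℕ) : expo (e 0) (e 1) (e 2) = e := by
  ext k
  fin_cases k <;> rfl

theorem expo_add (i j n i' j' n' : ℕ) :
    expo i j n + expo i' j' n' = expo (i + i') (j + j') (n + n') := by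
  ext k
  fin_cases k <;> rfl

theorem expo_inj {i j n i' j' n' : ℕ} :
    expo i j n = expo i' j' n' ↔ i = i' ∧ j = j' ∧ n = n' := by
  constructor
  · intro h
    exact ⟨DFunLike.congr_fun h 0, DFunLike.congr_fun h 1, DFunLike.congr_fun h 2⟩
  · rintro ⟨rfl, rfl, rfl⟩; rfl

/-- The coefficient of `x ^ i * y ^ j`, as a power series in `t`. -/
noncomputable def rowSeries (i j : ℕ) (F : MvPowerSeries (Fin 3) ℚ) : PowerSeries ℚ :=
  PowerSeries.mk fun n => MvPowerSeries.coeff (expo i j n) F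

/-- If $p$ has no term of degree below $i+j$ in $x,y$, a contribution to $x^iy^j$ in $pF$ uses all
of that degree from $p$ and hence only the $x^0y^0$ part of $F$. -/
theorem rowSeries_mul {i j : ℕ} {p : MvPowerSeries (Fin 3) ℚ}
    (hp : ∀ i' j', i' + j' < i + j → rowSeries i' j' p = 0) (F : MvPowerSeries (Fin 3) ℚ) :
    rowSeries i j (p * F) = rowSeries i j p * rowSeries 0 0 F := by
  classical
  ext n
  rw [rowSeries, PowerSeries.coeff_mk, MvPowerSeries.coeff_mul, PowerSeries.coeff_mul]
  simp only [rowSeries, PowerSeries.coeff_mk]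
  symm
  refine Finset.sum_of_injOn (fun q : ℕ × ℕ => (expo i j q.1, expo 0 0 q.2)) ?_ ?_ ?_ ?_
  · rintro ⟨a, b⟩ _ ⟨a', b'⟩ _ h
    simp only [Prod.mk.injEq, expo_inj] at h
    exact Prod.ext h.1.2.2 h.2.2.2
  · rintro ⟨a, b⟩ h
    simp only [Finset.mem_coe, Finset.HasAntidiagonal.mem_antidiagonal] at h ⊢
    rw [expo_add, h, add_zero, add_zero]
  · rintro ⟨d, e⟩ hde hne
    rw [Finset.HasAntidiagonal.mem_antidiagonal] at hde
    have h0 : d 0 + e 0 = i := DFunLike.congr_fun hde 0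
    have h1 : d 1 + e 1 = j := DFunLike.congr_fun hde 1
    have h2 : d 2 + e 2 = n := DFunLike.congr_fun hde 2
    have hlt : d 0 + d 1 < i + j := by
      by_contra hcon
      refine hne ⟨(d 2, e 2), by simpa using h2, ?_⟩
      rw [Prod.mk.injEq]
      constructor
      · exact (expo_inj.mpr ⟨by omega, by omega, rfl⟩).trans (expo_self d)
      · exact (expo_inj.mpr ⟨by omega, by omega, rfl⟩).trans (expo_self e)
    have := congrArg (PowerSeries.coeff (d 2)) (hp _ _ hlt)
    rw [rowSeries, PowerSeries.coeff_mk, expo_self, map_zero] at this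
    simp only
    rw [this, zero_mul]
  · rintro ⟨a, b⟩ _
    rfl

theorem rowSeries_zero_zero_pow (F : MvPowerSeries (Fin 3) ℚ) (k : ℕ) :
    rowSeries 0 0 (F ^ k) = rowSeries 0 0 F ^ k := by
  induction k with
  | zero =>
    ext n
    rw [pow_zero, pow_zero, rowSeries, PowerSeries.coeff_mk, MvPowerSeries.coeff_one,
      PowerSeries.coeff_one]
    refine if_congr ?_ rfl rfl
    rw [show (0 : Fin 3 →₀ ℕ) = expo 0 0 0 from (expo_self 0).symm, expo_inj]
    simp
  | succ k ih =>
    rw [pow_succ, pow_succ, rowSeries_mul (fun i' j' h => absurd h (by omega)), ih]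

/-- The coefficient of `x ^ i * y ^ j` in a polynomial. -/
noncomputable def rowPoly (i j : ℕ) (p : MvPolynomial (Fin 3) ℚ) : Polynomial ℚ :=
  ∑ n ∈ Finset.range (p.totalDegree + 1), Polynomial.monomial n (p.coeff (expo i j n))

theorem coe_rowPoly (i j : ℕ) (p : MvPolynomial (Fin 3) ℚ) :
    (rowPoly i j p : PowerSeries ℚ) = rowSeries i j (p : MvPowerSeries (Fin 3) ℚ) := by
  ext n
  rw [Polynomial.coeff_coe, rowSeries, PowerSeries.coeff_mk, MvPolynomial.coeff_coe, rowPoly]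
  simp only [Polynomial.finsetSum_coeff, Polynomial.coeff_monomial]
  rw [Finset.sum_ite_eq' (Finset.range _) n]
  split_ifs with h
  · rfl
  · rw [MvPolynomial.coeff_eq_zero_of_totalDegree_lt]
    rw [Finset.mem_range] at h
    have : n ≤ ∑ k ∈ (expo i j n).support, expo i j n k := by
      by_cases hn : n = 0
      · omega
      · exact Finset.single_le_sum (f := fun k => expo i j n k) (fun _ _ => Nat.zero_le _)
          (Finsupp.mem_support_iff.mpr (show expo i j n 2 ≠ 0 from hn))
    omega

/-- A power series in `x, y, t` is transcendental if its value at `x = y = 0` is. -/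
theorem transcendental_of_rowSeries {F : MvPowerSeries (Fin 3) ℚ}
    (hF : Transcendental (Polynomial ℚ) (rowSeries 0 0 F)) :
    Transcendental (MvPolynomial (Fin 3) ℚ) F := by
  classical
  rintro ⟨P, hP0, hP⟩
  -- Setting $x=y=0$ in $P$ could give zero. Instead the coefficient of some $x^iy^j$ is extracted,
  -- with $i+j$ minimal over all coefficients of $P$; it is a nonzero polynomial that annihilates
  -- $F(0,0;t)$.
  have hex : ∃ d i j k, i + j = d ∧ rowSeries i j (P.coeff k : MvPowerSeries (Fin 3) ℚ) ≠ 0 := by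
    obtain ⟨k, hk⟩ : ∃ k, P.coeff k ≠ 0 := by
      by_contra! h
      exact hP0 (Polynomial.ext (by simpa using h))
    obtain ⟨e, he⟩ := MvPolynomial.ne_zero_iff.mp hk
    refine ⟨_, e 0, e 1, k, rfl, fun h => he ?_⟩
    have := congrArg (PowerSeries.coeff (e 2)) h
    rwa [rowSeries, PowerSeries.coeff_mk, expo_self, MvPolynomial.coeff_coe, map_zero] at this
  obtain ⟨i, j, k, hd, hk⟩ := Nat.find_spec hex
  have hmin : ∀ k i' j', i' + j' < i + j →
      rowSeries i' j' (P.coeff k : MvPowerSeries (Fin 3) ℚ) = 0 := by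
    intro k i' j' hlt
    by_contra h
    exact Nat.find_min hex (hd ▸ hlt) ⟨i', j', k, rfl, h⟩
  refine hF ⟨∑ k ∈ Finset.range (P.natDegree + 1), Polynomial.monomial k (rowPoly i j (P.coeff k)),
    fun h => hk ?_, ?_⟩
  · have h1 := congrArg (fun Q => Q.coeff k) h
    simp only [Polynomial.finsetSum_coeff, Polynomial.coeff_monomial, Polynomial.coeff_zero] at h1
    rw [Finset.sum_ite_eq' (Finset.range _) k] at h1
    rw [← coe_rowPoly]
    split_ifs at h1 with hkr
    · rw [h1, Polynomial.coe_zero]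
    · rw [Finset.mem_range] at hkr
      rw [Polynomial.coeff_eq_zero_of_natDegree_lt (by omega)]
      ext n
      simp [rowPoly]
  · rw [map_sum]
    have h1 : ∑ k ∈ Finset.range (P.natDegree + 1),
        rowSeries i j ((P.coeff k : MvPowerSeries (Fin 3) ℚ) * F ^ k) = 0 := by
      rw [Polynomial.aeval_eq_sum_range] at hP
      ext n
      have h2 := congrArg (MvPowerSeries.coeff (expo i j n)) hP
      rw [map_sum, map_zero] at h2
      rw [map_sum, map_zero, ← h2]
      refine Finset.sum_congr rfl fun k _ => ?_
      rw [rowSeries, PowerSeries.coeff_mk, Algebra.smul_def]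
      rfl
    rw [← h1]
    refine Finset.sum_congr rfl fun k _ => ?_
    rw [Polynomial.aeval_monomial, rowSeries_mul (hmin k), rowSeries_zero_zero_pow, ← coe_rowPoly]
    rfl

theorem coeff_toThreeVar_walkSeries (S : Finset (ℤ × ℤ)) (i j n : ℕ) :
    MvPowerSeries.coeff (expo i j n) (toThreeVar (walkSeries S)) = walkCount S i j n := by
  have h : MvPowerSeries.coeff (expo i j n) (toThreeVar (walkSeries S)) =
      MvPolynomial.coeff (Finsupp.equivFunOnFinite.symm ![i, j])
        (PowerSeries.coeff n (walkSeries S)) := rfl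
  rw [h, walkSeries, PowerSeries.coeff_mk, MvPolynomial.coeff_sum, ← sum_quadrantWalks_ite_eq]
  refine Finset.sum_congr rfl fun w hw => ?_
  have hw := quadrantWalks_end_nonneg hw
  rw [MvPolynomial.X_pow_eq_monomial, MvPolynomial.X_pow_eq_monomial, MvPolynomial.monomial_mul,
    MvPolynomial.coeff_monomial, mul_one]
  refine if_congr ?_ rfl rfl
  rw [Finsupp.ext_iff, Fin.forall_fin_two, Prod.ext_iff]
  simp
  omega

theorem transcendental_walkSeries :
    Transcendental (MvPolynomial (Fin 3) ℚ) (toThreeVar (walkSeries tandemSteps)) := by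
  apply transcendental_of_rowSeries
  convert transcendental_excursions using 1
  ext n
  rw [rowSeries, PowerSeries.coeff_mk, coeff_toThreeVar_walkSeries, coeff_specialize_zero_zero]

end ThreeVar

/-! ### D-finiteness criterion -/

section DFinite

/-- The power series that are linear combinations of elements of `s` over the field of rational
functions. -/
def satSpan (s : Set (MvPowerSeries (Fin 3) ℚ)) :
    Submodule (MvPolynomial (Fin 3) ℚ) (MvPowerSeries (Fin 3) ℚ) where
  carrier := {f | ∃ d : MvPolynomial (Fin 3) ℚ, d ≠ 0 ∧
    d • f ∈ Submodule.span (MvPolynomial (Fin 3) ℚ) s}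
  add_mem' := by
    rintro f g ⟨d, hd, hf⟩ ⟨d', hd', hg⟩
    refine ⟨d * d', mul_ne_zero hd hd', ?_⟩
    have e : (d * d') • (f + g) = d' • d • f + d • d' • g := by
      rw [smul_add, mul_smul, mul_smul, smul_comm d d' f]
    rw [e]
    exact add_mem (Submodule.smul_mem _ _ hf) (Submodule.smul_mem _ _ hg)
  zero_mem' := ⟨1, one_ne_zero, by simp⟩
  smul_mem' := by
    rintro c f ⟨d, hd, hf⟩
    exact ⟨d, hd, by rw [smul_comm]; exact Submodule.smul_mem _ _ hf⟩

theorem subset_satSpan (s : Set (MvPowerSeries (Fin 3) ℚ)) {f : MvPowerSeries (Fin 3) ℚ}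
    (hf : f ∈ s) : f ∈ satSpan s :=
  ⟨1, one_ne_zero, by rw [one_smul]; exact Submodule.subset_span hf⟩

theorem span_le_satSpan (s : Set (MvPowerSeries (Fin 3) ℚ)) :
    Submodule.span (MvPolynomial (Fin 3) ℚ) s ≤ satSpan s :=
  Submodule.span_le.mpr fun _ hf => subset_satSpan s hf

theorem satSpan_mono {s t : Set (MvPowerSeries (Fin 3) ℚ)} (h : s ⊆ t) :
    satSpan s ≤ satSpan t := fun _ ⟨d, hd, hf⟩ => ⟨d, hd, Submodule.span_mono h hf⟩

theorem mem_satSpan_of_smul_mem {s : Set (MvPowerSeries (Fin 3) ℚ)} {d : MvPolynomial (Fin 3) ℚ}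
    (hd : d ≠ 0) {f : MvPowerSeries (Fin 3) ℚ} (hf : d • f ∈ satSpan s) : f ∈ satSpan s := by
  obtain ⟨d', hd', h⟩ := hf
  exact ⟨d' * d, mul_ne_zero hd' hd, by rwa [mul_smul]⟩

theorem mvPolynomial_smul_eq (p : MvPolynomial (Fin 3) ℚ) (f : MvPowerSeries (Fin 3) ℚ) :
    p • f = (p : MvPowerSeries (Fin 3) ℚ) * f := by
  rw [Algebra.smul_def]
  rfl

theorem pderiv_smul (i : Fin 3) (p : MvPolynomial (Fin 3) ℚ) (f : MvPowerSeries (Fin 3) ℚ) :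
    MvPowerSeries.pderiv ℚ i (p • f) =
      p • MvPowerSeries.pderiv ℚ i f + (MvPolynomial.pderiv i p) • f := by
  simp only [mvPolynomial_smul_eq, Derivation.leibniz, MvPowerSeries.pderiv_coe, smul_eq_mul]
  ring

/-- The span of `s` over the rational functions is stable under derivations. -/
def DerivClosed (s : Set (MvPowerSeries (Fin 3) ℚ)) : Prop :=
  ∀ g ∈ s, ∀ i : Fin 3, MvPowerSeries.X i * MvPowerSeries.pderiv ℚ i g ∈ satSpan s

theorem DerivClosed.union {s t : Set (MvPowerSeries (Fin 3) ℚ)} (hs : DerivClosed s)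
    (ht : DerivClosed t) : DerivClosed (s ∪ t) := by
  rintro g (hg | hg) i
  · exact satSpan_mono Set.subset_union_left (hs g hg i)
  · exact satSpan_mono Set.subset_union_right (ht g hg i)

theorem derivClosed_one : DerivClosed {1} := by
  rintro g rfl i
  rw [MvPowerSeries.pderiv_one, mul_zero]
  exact zero_mem _

/-- Since $X_i$ is a nonzero scalar, $X_i\partial_i g$ is as good as $\partial_i g$ on generators.
The Leibniz rule handles polynomial coefficients, and $d\,\partial f=\partial(df)-(\partial d)f$
handles a common denominator $d$. -/
theorem DerivClosed.pderiv_mem {s : Set (MvPowerSeries (Fin 3) ℚ)} (hs : DerivClosed s)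
    (i : Fin 3) {f : MvPowerSeries (Fin 3) ℚ} (hf : f ∈ satSpan s) :
    MvPowerSeries.pderiv ℚ i f ∈ satSpan s := by
  have h : ∀ b ∈ Submodule.span (MvPolynomial (Fin 3) ℚ) s,
      MvPowerSeries.pderiv ℚ i b ∈ satSpan s := by
    intro b hb
    induction hb using Submodule.span_induction with
    | mem g hg =>
      refine mem_satSpan_of_smul_mem (MvPolynomial.X_ne_zero i) ?_
      rw [mvPolynomial_smul_eq, MvPolynomial.coe_X]
      exact hs g hg i
    | zero => rw [map_zero]; exact zero_mem _
    | add f g _ _ hf hg => rw [map_add]; exact add_mem hf hg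
    | smul a f hf ih =>
      rw [pderiv_smul]
      exact add_mem (Submodule.smul_mem _ _ ih) (Submodule.smul_mem _ _ (span_le_satSpan s hf))
  obtain ⟨d, hd, hdf⟩ := hf
  refine mem_satSpan_of_smul_mem hd ?_
  rw [eq_sub_iff_add_eq.mpr (pderiv_smul i d f).symm]
  exact sub_mem (h _ hdf) (Submodule.smul_mem _ _ ⟨d, hd, hdf⟩)

/-- A power series in the span of a finite set that is stable under derivations is D-finite. -/
theorem isDFinite_of_mem_satSpan {s : Set (MvPowerSeries (Fin 3) ℚ)} (hfin : s.Finite)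
    (hs : DerivClosed s) {F : MvPowerSeries (Fin 3) ℚ} (hF : F ∈ satSpan s) : IsDFinite F := by
  let alg : Algebra (FractionRing (MvPolynomial (Fin 3) ℚ))
      (FractionRing (MvPowerSeries (Fin 3) ℚ)) :=
    FractionRing.liftAlgebra (MvPolynomial (Fin 3) ℚ) (FractionRing (MvPowerSeries (Fin 3) ℚ))
  have tower : IsScalarTower (MvPolynomial (Fin 3) ℚ) (FractionRing (MvPolynomial (Fin 3) ℚ))
      (FractionRing (MvPowerSeries (Fin 3) ℚ)) := FractionRing.isScalarTower_liftAlgebra _ _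
  set ι := algebraMap (MvPowerSeries (Fin 3) ℚ) (FractionRing (MvPowerSeries (Fin 3) ℚ))
  set W := Submodule.span (FractionRing (MvPolynomial (Fin 3) ℚ)) (ι '' s) with hW
  have hsmul : ∀ (a : MvPolynomial (Fin 3) ℚ) (f : MvPowerSeries (Fin 3) ℚ),
      ι (a • f) = algebraMap _ (FractionRing (MvPolynomial (Fin 3) ℚ)) a • ι f := by
    intro a f
    rw [algebraMap_smul, Algebra.smul_def, map_mul, Algebra.smul_def]
    rw [IsScalarTower.algebraMap_apply (MvPolynomial (Fin 3) ℚ) (MvPowerSeries (Fin 3) ℚ)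
      (FractionRing (MvPowerSeries (Fin 3) ℚ))]
  have hspan : ∀ b ∈ Submodule.span (MvPolynomial (Fin 3) ℚ) s, ι b ∈ W := by
    intro b hb
    induction hb using Submodule.span_induction with
    | mem g hg => exact Submodule.subset_span ⟨g, hg, rfl⟩
    | zero => rw [map_zero]; exact zero_mem _
    | add f g _ _ hf hg => rw [map_add]; exact add_mem hf hg
    | smul a f _ ih => rw [hsmul]; exact Submodule.smul_mem _ _ ih
  have hsat : ∀ f ∈ satSpan s, ι f ∈ W := by
    rintro f ⟨d, hd, hdf⟩
    have h1 := hspan _ hdf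
    rw [hsmul] at h1
    have h2 : algebraMap _ (FractionRing (MvPolynomial (Fin 3) ℚ)) d ≠ 0 := by
      rwa [Ne, map_eq_zero_iff _ (IsFractionRing.injective _ _)]
    rwa [Submodule.smul_mem_iff _ h2] at h1
  have hiter : ∀ l : List (Fin 3), iterPDeriv l F ∈ satSpan s := by
    intro l
    induction l with
    | nil => exact hF
    | cons i l ih => exact hs.pderiv_mem i ih
  have hle : Submodule.span (FractionRing (MvPolynomial (Fin 3) ℚ))
      (Set.range fun l : List (Fin 3) => ι (iterPDeriv l F)) ≤ W := by
    rw [Submodule.span_le]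
    rintro _ ⟨l, rfl⟩
    exact hsat _ (hiter l)
  have : FiniteDimensional (FractionRing (MvPolynomial (Fin 3) ℚ)) W :=
    FiniteDimensional.span_of_finite _ (hfin.image ι)
  exact Submodule.finiteDimensional_of_le hle

/-! #### Series multiplied termwise by polynomials in the exponents -/

/-- The termwise product of the coefficients of `G` with `h`. -/
def termwise (h : (Fin 3 →₀ ℕ) → ℚ) (G : MvPowerSeries (Fin 3) ℚ) : MvPowerSeries (Fin 3) ℚ :=
  fun e => h e * G e

theorem termwise_add (h h' : (Fin 3 →₀ ℕ) → ℚ) (G : MvPowerSeries (Fin 3) ℚ) :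
    termwise (h + h') G = termwise h G + termwise h' G := by
  funext e
  exact add_mul _ _ _

theorem termwise_smul (c : ℚ) (h : (Fin 3 →₀ ℕ) → ℚ) (G : MvPowerSeries (Fin 3) ℚ) :
    termwise (c • h) G = (MvPolynomial.C c : MvPolynomial (Fin 3) ℚ) • termwise h G := by
  rw [mvPolynomial_smul_eq, MvPolynomial.coe_C]
  ext e
  rw [MvPowerSeries.coeff_C_mul]
  exact mul_assoc _ _ _

theorem termwise_zero (G : MvPowerSeries (Fin 3) ℚ) : termwise 0 G = 0 := by
  funext e
  exact zero_mul _

/-- This turns the study of derivations into that of termwise products with the exponents. -/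
theorem X_mul_pderiv (i : Fin 3) (G : MvPowerSeries (Fin 3) ℚ) :
    MvPowerSeries.X i * MvPowerSeries.pderiv ℚ i G = termwise (fun e => e i) G := by
  classical
  ext e
  rw [MvPowerSeries.X, MvPowerSeries.coeff_monomial_mul]
  change _ = (e i : ℚ) * MvPowerSeries.coeff e G
  split_ifs with h
  · rw [MvPowerSeries.coeff_pderiv, tsub_add_cancel_of_le h, one_mul]
    have h1 : 1 ≤ e i := by simpa using h i
    rw [Finsupp.tsub_apply, Finsupp.single_eq_same, Nat.cast_sub h1]
    push_cast
    ring
  · rw [Finsupp.single_le_iff] at h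
    have : e i = 0 := by omega
    rw [this]
    simp

theorem termwise_termwise (h h' : (Fin 3 →₀ ℕ) → ℚ) (G : MvPowerSeries (Fin 3) ℚ) :
    termwise h (termwise h' G) = termwise (h * h') G := by
  funext e
  exact (mul_assoc _ _ _).symm

/-- A recurrence relation for the coefficients of `G`, multiplied by `h`. -/
theorem termwise_eq_monomial_smul {G : MvPowerSeries (Fin 3) ℚ} {h₁ h₂ : (Fin 3 →₀ ℕ) → ℚ}
    {s : Fin 3 →₀ ℕ}
    (hrec : ∀ e, h₁ e * G e = if s ≤ e then h₂ (e - s) * G (e - s) else 0)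
    (h : (Fin 3 →₀ ℕ) → ℚ) :
    termwise (h * h₁) G = (MvPolynomial.monomial s 1 : MvPolynomial (Fin 3) ℚ) •
      termwise ((fun e => h (e + s)) * h₂) G := by
  classical
  rw [mvPolynomial_smul_eq, MvPolynomial.coe_monomial]
  ext e
  rw [MvPowerSeries.coeff_monomial_mul]
  change h e * h₁ e * G e =
    if s ≤ e then 1 * (h (e - s + s) * h₂ (e - s) * G (e - s)) else 0
  rw [mul_assoc, hrec]
  split_ifs with hs
  · rw [tsub_add_cancel_of_le hs]
    ring
  · rw [mul_zero]

/-- The functions that are polynomials in `X` and `Y` of total degree less than `d`. -/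
def polyLT (X Y : (Fin 3 →₀ ℕ) → ℚ) (d : ℕ) : Submodule ℚ ((Fin 3 →₀ ℕ) → ℚ) :=
  Submodule.span ℚ {f | ∃ a b, a + b < d ∧ f = X ^ a * Y ^ b}

theorem mul_mem_polyLT {X Y : (Fin 3 →₀ ℕ) → ℚ} {d e : ℕ} {f g : (Fin 3 →₀ ℕ) → ℚ}
    (hf : f ∈ polyLT X Y d) (hg : g ∈ polyLT X Y (e + 1)) : f * g ∈ polyLT X Y (d + e) := by
  have h : polyLT X Y d * polyLT X Y (e + 1) ≤ polyLT X Y (d + e) := by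
    rw [polyLT, polyLT, Submodule.span_mul_span, Submodule.span_le]
    rintro _ ⟨_, ⟨a, b, hab, rfl⟩, _, ⟨a', b', hab', rfl⟩, rfl⟩
    exact Submodule.subset_span ⟨a + a', b + b', by omega, by simp only [pow_add]; ring⟩
  exact h (Submodule.mul_mem_mul hf hg)

/-- `f` and `g` are polynomials in `X` and `Y` of degree at most `d` that have the same
homogeneous part of degree `d`. -/
structure SameLead (X Y : (Fin 3 →₀ ℕ) → ℚ) (d : ℕ) (f g : (Fin 3 →₀ ℕ) → ℚ) : Prop where
  left : f ∈ polyLT X Y (d + 1)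
  right : g ∈ polyLT X Y (d + 1)
  sub_mem : f - g ∈ polyLT X Y d

theorem SameLead.mul {X Y : (Fin 3 →₀ ℕ) → ℚ} {d e : ℕ} {f g f' g' : (Fin 3 →₀ ℕ) → ℚ}
    (h : SameLead X Y d f g) (h' : SameLead X Y e f' g') :
    SameLead X Y (d + e) (f * f') (g * g') := by
  refine ⟨?_, ?_, ?_⟩
  · rw [add_right_comm]
    exact mul_mem_polyLT h.left h'.left
  · rw [add_right_comm]
    exact mul_mem_polyLT h.right h'.right
  · have e1 : f * f' - g * g' = (f - g) * f' + (f' - g') * g := by ring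
    rw [e1]
    refine add_mem (mul_mem_polyLT h.sub_mem h'.left) ?_
    rw [add_comm d e]
    exact mul_mem_polyLT h'.sub_mem h.right

theorem SameLead.add {X Y : (Fin 3 →₀ ℕ) → ℚ} {d : ℕ} {f g f' g' : (Fin 3 →₀ ℕ) → ℚ}
    (h : SameLead X Y d f g) (h' : SameLead X Y d f' g') :
    SameLead X Y d (f + f') (g + g') := by
  refine ⟨add_mem h.left h'.left, add_mem h.right h'.right, ?_⟩
  rw [add_sub_add_comm]
  exact add_mem h.sub_mem h'.sub_mem

theorem SameLead.smul {X Y : (Fin 3 →₀ ℕ) → ℚ} {d : ℕ} {f g : (Fin 3 →₀ ℕ) → ℚ}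
    (h : SameLead X Y d f g) (c : ℚ) : SameLead X Y d (c • f) (c • g) := by
  refine ⟨Submodule.smul_mem _ _ h.left, Submodule.smul_mem _ _ h.right, ?_⟩
  rw [← smul_sub]
  exact Submodule.smul_mem _ _ h.sub_mem

theorem sameLead_self {X Y : (Fin 3 →₀ ℕ) → ℚ} {d : ℕ} {f : (Fin 3 →₀ ℕ) → ℚ}
    (hf : f ∈ polyLT X Y (d + 1)) : SameLead X Y d f f :=
  ⟨hf, hf, by rw [sub_self]; exact zero_mem _⟩

theorem pow_mul_pow_mem_polyLT (X Y : (Fin 3 →₀ ℕ) → ℚ) {a b d : ℕ} (h : a + b < d) :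
    X ^ a * Y ^ b ∈ polyLT X Y d := Submodule.subset_span ⟨a, b, h, rfl⟩

theorem one_mem_polyLT (X Y : (Fin 3 →₀ ℕ) → ℚ) {d : ℕ} (hd : 0 < d) : 1 ∈ polyLT X Y d := by
  simpa using pow_mul_pow_mem_polyLT X Y (a := 0) (b := 0) hd

theorem sameLead_X (X Y : (Fin 3 →₀ ℕ) → ℚ) : SameLead X Y 1 X X :=
  sameLead_self (by simpa using pow_mul_pow_mem_polyLT X Y (a := 1) (b := 0) (d := 2) (by omega))

theorem sameLead_Y (X Y : (Fin 3 →₀ ℕ) → ℚ) : SameLead X Y 1 Y Y :=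
  sameLead_self (by simpa using pow_mul_pow_mem_polyLT X Y (a := 0) (b := 1) (d := 2) (by omega))

theorem SameLead.add_const {X Y : (Fin 3 →₀ ℕ) → ℚ} {d : ℕ} {f g : (Fin 3 →₀ ℕ) → ℚ}
    (h : SameLead X Y (d + 1) f g) (c : ℚ) : SameLead X Y (d + 1) (f + c • 1) g := by
  refine ⟨add_mem h.left (Submodule.smul_mem _ _ (one_mem_polyLT X Y (by omega))), h.right, ?_⟩
  rw [add_sub_right_comm]
  exact add_mem h.sub_mem (Submodule.smul_mem _ _ (one_mem_polyLT X Y (by omega)))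

theorem SameLead.pow {X Y f g : (Fin 3 →₀ ℕ) → ℚ} (h : SameLead X Y 1 f g) (n : ℕ) :
    SameLead X Y n (f ^ n) (g ^ n) := by
  induction n with
  | zero =>
    rw [pow_zero, pow_zero]
    exact sameLead_self (one_mem_polyLT X Y (by omega))
  | succ n ih =>
    rw [pow_succ, pow_succ]
    exact ih.mul h

/-- The series `X ^ a Y ^ b G` with `a + b < N`. -/
def termwiseSet (X Y : (Fin 3 →₀ ℕ) → ℚ) (G : MvPowerSeries (Fin 3) ℚ) (N : ℕ) :
    Set (MvPowerSeries (Fin 3) ℚ) :=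
  {f | ∃ a b, a + b < N ∧ f = termwise (X ^ a * Y ^ b) G}

theorem termwiseSet_finite (X Y : (Fin 3 →₀ ℕ) → ℚ) (G : MvPowerSeries (Fin 3) ℚ) (N : ℕ) :
    (termwiseSet X Y G N).Finite := by
  refine ((Finset.range N ×ˢ Finset.range N).finite_toSet.image
    fun p => termwise (X ^ p.1 * Y ^ p.2) G).subset ?_
  rintro _ ⟨a, b, h, rfl⟩
  refine ⟨(a, b), ?_, rfl⟩
  simp
  omega

theorem termwise_mem_satSpan {X Y : (Fin 3 →₀ ℕ) → ℚ} (G : MvPowerSeries (Fin 3) ℚ) {N : ℕ}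
    {h : (Fin 3 →₀ ℕ) → ℚ} (hh : h ∈ polyLT X Y N) :
    termwise h G ∈ satSpan (termwiseSet X Y G N) := by
  induction hh using Submodule.span_induction with
  | mem f hf =>
    obtain ⟨a, b, hab, rfl⟩ := hf
    exact subset_satSpan _ ⟨a, b, hab, rfl⟩
  | zero => rw [termwise_zero]; exact zero_mem _
  | add f g _ _ hf hg => rw [termwise_add]; exact add_mem hf hg
  | smul c f _ ih => rw [termwise_smul]; exact Submodule.smul_mem _ _ ih

theorem SameLead.mk_termwise_eq {X Y : (Fin 3 →₀ ℕ) → ℚ} (G : MvPowerSeries (Fin 3) ℚ) {N : ℕ}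
    {f g : (Fin 3 →₀ ℕ) → ℚ} (h : SameLead X Y N f g) :
    (satSpan (termwiseSet X Y G N)).mkQ (termwise f G) =
      (satSpan (termwiseSet X Y G N)).mkQ (termwise g G) := by
  rw [Submodule.mkQ_apply, Submodule.mkQ_apply, Submodule.Quotient.eq]
  have := termwise_mem_satSpan G h.sub_mem
  rwa [sub_eq_add_neg, termwise_add, ← neg_one_smul ℚ, termwise_smul, map_neg, map_one,
    neg_one_smul, ← sub_eq_add_neg] at this

/-- If the exponents of `G` are linear in `X` and `Y`, and if the products of `G` with the
monomials of degree `N` reduce to lower degrees, then the span of the products of `G` with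
monomials of degree less than `N` is stable under derivations. -/
theorem derivClosed_termwiseSet {X Y : (Fin 3 →₀ ℕ) → ℚ} {G : MvPowerSeries (Fin 3) ℚ} {N : ℕ}
    (hlin : ∀ i : Fin 3, ∃ α β : ℚ, ∀ e, G e ≠ 0 → (e i : ℚ) = α * X e + β * Y e)
    (hred : ∀ a b, a + b = N → termwise (X ^ a * Y ^ b) G ∈ satSpan (termwiseSet X Y G N)) :
    DerivClosed (termwiseSet X Y G N) := by
  have hall : ∀ a b, a + b ≤ N → termwise (X ^ a * Y ^ b) G ∈ satSpan (termwiseSet X Y G N) := by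
    intro a b hab
    rcases hab.lt_or_eq with h | h
    · exact subset_satSpan _ ⟨a, b, h, rfl⟩
    · exact hred a b h
  rintro _ ⟨a, b, hab, rfl⟩ i
  obtain ⟨α, β, h⟩ := hlin i
  have e1 : MvPowerSeries.X i * MvPowerSeries.pderiv ℚ i (termwise (X ^ a * Y ^ b) G) =
      termwise (α • (X ^ (a + 1) * Y ^ b) + β • (X ^ a * Y ^ (b + 1))) G := by
    rw [X_mul_pderiv, termwise_termwise]
    funext e
    by_cases hG : G e = 0
    · simp [termwise, hG]
    · simp only [termwise, Pi.mul_apply, Pi.pow_apply, Pi.add_apply, Pi.smul_apply, smul_eq_mul,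
        h e hG]
      ring
  rw [e1, termwise_add, termwise_smul, termwise_smul]
  exact add_mem (Submodule.smul_mem _ _ (hall _ _ (by omega)))
    (Submodule.smul_mem _ _ (hall _ _ (by omega)))

end DFinite

/-! ### D-finiteness of `Q(x, y; t)` -/

section WalkSeriesDFinite

/-- The consequence for the top degree parts of a recurrence relation for the coefficients of
`G`. -/
theorem mkQ_termwise_eq {X Y : (Fin 3 →₀ ℕ) → ℚ} {G : MvPowerSeries (Fin 3) ℚ}
    {h₁ h₂ g₁ g₂ : (Fin 3 →₀ ℕ) → ℚ} {s : Fin 3 →₀ ℕ} {α β : ℚ} {d N : ℕ}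
    (hrec : ∀ e, h₁ e * G e = if s ≤ e then h₂ (e - s) * G (e - s) else 0)
    (hX : ∀ e, X (e + s) = X e + α) (hY : ∀ e, Y (e + s) = Y e + β)
    (hg₁ : SameLead X Y d h₁ g₁) (hg₂ : SameLead X Y d h₂ g₂) (a b : ℕ) (hN : a + b + d = N) :
    (satSpan (termwiseSet X Y G N)).mkQ (termwise (X ^ a * Y ^ b * g₁) G) =
      (MvPolynomial.monomial s 1 : MvPolynomial (Fin 3) ℚ) •
        (satSpan (termwiseSet X Y G N)).mkQ (termwise (X ^ a * Y ^ b * g₂) G) := by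
  subst hN
  have e1 := ((((sameLead_X X Y).pow a).mul ((sameLead_Y X Y).pow b)).mul hg₁).mk_termwise_eq G
  -- A shift of the exponents by $s$ replaces $X,Y$ by $X+\alpha,Y+\beta$, which leaves the top
  -- degree part unchanged.
  have e2 := (((((sameLead_X X Y).add_const α).pow a).mul
    (((sameLead_Y X Y).add_const β).pow b)).mul hg₂).mk_termwise_eq G
  rw [← e1, ← e2, termwise_eq_monomial_smul hrec, map_smul]
  congr 4
  funext e
  simp [hX, hY]

theorem mkQ_termwise_add_smul {S : Submodule (MvPolynomial (Fin 3) ℚ) (MvPowerSeries (Fin 3) ℚ)}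
    (G : MvPowerSeries (Fin 3) ℚ) (f g : (Fin 3 →₀ ℕ) → ℚ) (c : ℚ) :
    S.mkQ (termwise (f + c • g) G) = S.mkQ (termwise f G) +
      (MvPolynomial.C c : MvPolynomial (Fin 3) ℚ) • S.mkQ (termwise g G) := by
  rw [termwise_add, termwise_smul, map_add, map_smul]

/-- The quotient by a saturated submodule is torsion-free, so linear systems over the polynomials
are solved in it as over their fraction field. -/
theorem eq_zero_of_smul_mkQ {s : Set (MvPowerSeries (Fin 3) ℚ)} (d : MvPolynomial (Fin 3) ℚ)
    (hd : d ≠ 0) (m : MvPowerSeries (Fin 3) ℚ ⧸ satSpan s) (h : d • m = 0) : m = 0 := by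
  obtain ⟨f, rfl⟩ := Submodule.mkQ_surjective _ m
  rw [← map_smul, Submodule.mkQ_apply, Submodule.Quotient.mk_eq_zero] at h
  rw [Submodule.mkQ_apply, Submodule.Quotient.mk_eq_zero]
  exact mem_satSpan_of_smul_mem hd h

theorem expo_le_expo {a b c i j n : ℕ} : expo a b c ≤ expo i j n ↔ a ≤ i ∧ b ≤ j ∧ c ≤ n := by
  constructor
  · intro h; exact ⟨h 0, h 1, h 2⟩
  · rintro ⟨h0, h1, h2⟩ k
    fin_cases k
    exacts [h0, h1, h2]

theorem expo_sub_expo (a b c i j n : ℕ) :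
    expo i j n - expo a b c = expo (i - a) (j - b) (n - c) := by
  ext k
  fin_cases k <;> rfl

theorem forall_expo {p : (Fin 3 →₀ ℕ) → Prop} : (∀ e, p e) ↔ ∀ i j n, p (expo i j n) :=
  ⟨fun h _ _ _ => h _, fun h e => expo_self e ▸ h _ _ _⟩

/-! #### The series `Q(x, 0; t)` -/

/-- `Q(x, 0; t)` -/
def xAxisSeries : MvPowerSeries (Fin 3) ℚ := fun e =>
  if e 1 = 0 then (walkCount tandemSteps (e 0) 0 (e 2) : ℚ) else 0

theorem xAxisSeries_expo (i j n : ℕ) : xAxisSeries (expo i j n) =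
    if j = 0 then (walkCount tandemSteps i 0 n : ℚ) else 0 := rfl

/-- On the support $n=3m+2i$ one has $(n+i)/3=m+i$, and the left factors are $m(m+i+1)(m+i+2)$: this
is the quotient of closed forms for $m$ and $m-1$. Off the support both sides vanish. -/
theorem walkCount_xAxis_rec_t (i n : ℕ) :
    ((n : ℚ) - 2 * ((n + i) / 3)) * (((n + i) / 3 + 1) * ((n + i) / 3 + 2)) *
      walkCount tandemSteps i 0 n =
    if 3 ≤ n then (((n - 3 : ℕ) : ℚ) + 1) * ((((n - 3 : ℕ) : ℚ) + 2) * (((n - 3 : ℕ) : ℚ) + 3)) *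
      walkCount tandemSteps i 0 (n - 3) else 0 := by
  by_cases h : ∃ m, n = 3 * m + 2 * i + 0
  · obtain ⟨m, rfl⟩ := h
    rcases m with _ | m
    · trans 0
      · push_cast; ring
      · split_ifs with h3
        · rw [walkCount_eq_zero fun m => by omega, Nat.cast_zero, mul_zero]
        · rfl
    · have e : 3 * (m + 1) + 2 * i + 0 - 3 = 3 * m + 2 * i + 0 := by omega
      rw [if_pos (by omega), e, walkCount_eq, walkCount_eq,
        show 3 * (m + 1) + 2 * i + 0 = 3 * m + 2 * i + 0 + 1 + 1 + 1 by ring,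
        show m + 1 + i + 0 + 2 = m + i + 1 + 1 + 1 by ring,
        show m + 1 + i + 1 = m + i + 1 + 1 by ring, show m + i + 0 + 2 = m + i + 1 + 1 by ring,
        Nat.factorial_succ (3 * m + 2 * i + 0 + 1 + 1), Nat.factorial_succ (3 * m + 2 * i + 0 + 1),
        Nat.factorial_succ (3 * m + 2 * i + 0), Nat.factorial_succ m,
        Nat.factorial_succ (m + i + 1 + 1), Nat.factorial_succ (m + i + 1)]
      have h1 := Nat.factorial_ne_zero m
      have h2 := Nat.factorial_ne_zero (m + i + 1)
      push_cast
      field_simp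
      ring
  · rw [walkCount_eq_zero fun m hm => h ⟨m, hm⟩, Nat.cast_zero, mul_zero]
    split_ifs with h3
    · rw [walkCount_eq_zero fun m hm => h ⟨m + 1, by omega⟩, Nat.cast_zero, mul_zero]
    · rfl

/-- The quotient of closed forms for $i$ and $i-1$ at fixed $m$; here $3(n+i)/3-n$ is $i$, kept in
this shape as a polynomial in $(n+i)/3$ and $n$. -/
theorem walkCount_xAxis_rec_x (i n : ℕ) :
    (3 * (((n : ℚ) + i) / 3) - n) * (((n + i) / 3 + 1) * ((n + i) / 3 + 2)) *
      walkCount tandemSteps i 0 n =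
    if 1 ≤ i ∧ 2 ≤ n then
      (3 * ((((n - 2 : ℕ) : ℚ) + (i - 1 : ℕ)) / 3) - (n - 2 : ℕ) + 3) *
        ((((n - 2 : ℕ) : ℚ) + 1) * (((n - 2 : ℕ) : ℚ) + 2)) *
      walkCount tandemSteps (i - 1) 0 (n - 2) else 0 := by
  by_cases h : ∃ m, n = 3 * m + 2 * i + 0
  · obtain ⟨m, rfl⟩ := h
    rcases i with _ | i
    · rw [if_neg (by omega)]
      push_cast
      ring
    · have e : 3 * m + 2 * (i + 1) + 0 - 2 = 3 * m + 2 * i + 0 := by omega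
      rw [if_pos (by omega), e, Nat.add_sub_cancel, walkCount_eq, walkCount_eq,
        show 3 * m + 2 * (i + 1) + 0 = 3 * m + 2 * i + 0 + 1 + 1 by ring,
        show m + (i + 1) + 0 + 2 = m + i + 1 + 1 + 1 by ring,
        show m + (i + 1) + 1 = m + i + 1 + 1 by ring, show m + i + 0 + 2 = m + i + 1 + 1 by ring,
        Nat.factorial_succ (3 * m + 2 * i + 0 + 1),
        Nat.factorial_succ (3 * m + 2 * i + 0),
        Nat.factorial_succ (m + i + 1 + 1), Nat.factorial_succ (m + i + 1)]
      have h1 := Nat.factorial_ne_zero m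
      have h2 := Nat.factorial_ne_zero (m + i + 1)
      push_cast
      field_simp
      ring
  · rw [walkCount_eq_zero fun m hm => h ⟨m, hm⟩, Nat.cast_zero, mul_zero]
    split_ifs with h3
    · rw [walkCount_eq_zero fun m hm => h ⟨m, by omega⟩, Nat.cast_zero, mul_zero]
    · rfl

/-! #### The series `Q(0, y; t)` -/

/-- `Q(0, y; t)` -/
def yAxisSeries : MvPowerSeries (Fin 3) ℚ := fun e =>
  if e 0 = 0 then (walkCount tandemSteps 0 (e 1) (e 2) : ℚ) else 0

theorem yAxisSeries_expo (i j n : ℕ) : yAxisSeries (expo i j n) =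
    if i = 0 then (walkCount tandemSteps 0 j n : ℚ) else 0 := rfl

/-- On the support $(n-j)/3=m$, and the left factors are $m(m+1)(m+j+2)$. -/
theorem walkCount_yAxis_rec_t (j n : ℕ) :
    (((n : ℚ) - j) / 3) * ((((n : ℚ) - j) / 3 + 1) * (n - 2 * (((n : ℚ) - j) / 3) + 2)) *
      walkCount tandemSteps 0 j n =
    if 3 ≤ n then (((n - 3 : ℕ) : ℚ) + 1) * ((((n - 3 : ℕ) : ℚ) + 2) * (((n - 3 : ℕ) : ℚ) + 3)) *
      walkCount tandemSteps 0 j (n - 3) else 0 := by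
  by_cases h : ∃ m, n = 3 * m + 2 * 0 + j
  · obtain ⟨m, rfl⟩ := h
    rcases m with _ | m
    · trans 0
      · push_cast; ring
      · split_ifs with h3
        · rw [walkCount_eq_zero fun m => by omega, Nat.cast_zero, mul_zero]
        · rfl
    · have e : 3 * (m + 1) + 2 * 0 + j - 3 = 3 * m + 2 * 0 + j := by omega
      rw [if_pos (by omega), e, walkCount_eq, walkCount_eq,
        show 3 * (m + 1) + 2 * 0 + j = 3 * m + 2 * 0 + j + 1 + 1 + 1 by ring,
        show m + 1 + 0 + j + 2 = m + j + 2 + 1 by ring, show m + 0 + j + 2 = m + j + 2 by ring,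
        show m + 1 + 0 + 1 = m + 1 + 1 by ring, show m + 0 + 1 = m + 1 by ring,
        Nat.factorial_succ (3 * m + 2 * 0 + j + 1 + 1), Nat.factorial_succ (3 * m + 2 * 0 + j + 1),
        Nat.factorial_succ (3 * m + 2 * 0 + j), Nat.factorial_succ (m + 1),
        Nat.factorial_succ m, Nat.factorial_succ (m + j + 2)]
      have h1 := Nat.factorial_ne_zero m
      have h2 := Nat.factorial_ne_zero (m + j + 2)
      push_cast
      field_simp
      ring
  · rw [walkCount_eq_zero fun m hm => h ⟨m, hm⟩, Nat.cast_zero, mul_zero]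
    split_ifs with h3
    · rw [walkCount_eq_zero fun m hm => h ⟨m + 1, by omega⟩, Nat.cast_zero, mul_zero]
    · rfl

theorem walkCount_yAxis_rec_y (j n : ℕ) :
    ((n : ℚ) - 3 * (((n : ℚ) - j) / 3)) * (n - 2 * (((n : ℚ) - j) / 3) + 2) *
      walkCount tandemSteps 0 j n =
    if 1 ≤ j ∧ 1 ≤ n then
      (((n - 1 : ℕ) : ℚ) - 3 * ((((n - 1 : ℕ) : ℚ) - (j - 1 : ℕ)) / 3) + 3) *
        (((n - 1 : ℕ) : ℚ) + 1) *
      walkCount tandemSteps 0 (j - 1) (n - 1) else 0 := by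
  by_cases h : ∃ m, n = 3 * m + 2 * 0 + j
  · obtain ⟨m, rfl⟩ := h
    rcases j with _ | j
    · rw [if_neg (by omega)]
      push_cast
      ring
    · have e : 3 * m + 2 * 0 + (j + 1) - 1 = 3 * m + 2 * 0 + j := by omega
      rw [if_pos (by omega), e, Nat.add_sub_cancel, walkCount_eq, walkCount_eq,
        show 3 * m + 2 * 0 + (j + 1) = 3 * m + 2 * 0 + j + 1 by ring,
        show m + 0 + (j + 1) + 2 = m + j + 2 + 1 by ring, show m + 0 + j + 2 = m + j + 2 by ring,
        show m + 0 + 1 = m + 1 by ring, Nat.factorial_succ m,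
        Nat.factorial_succ (3 * m + 2 * 0 + j), Nat.factorial_succ (m + j + 2)]
      have h1 := Nat.factorial_ne_zero m
      have h2 := Nat.factorial_ne_zero (m + j + 2)
      push_cast
      field_simp
      ring
  · rw [walkCount_eq_zero fun m hm => h ⟨m, hm⟩, Nat.cast_zero, mul_zero]
    split_ifs with h3
    · rw [walkCount_eq_zero fun m hm => h ⟨m, by omega⟩, Nat.cast_zero, mul_zero]
    · rfl

/-! #### Linear algebra -/

/-- Used with $u=xt^2$, $v=t^3$ and $E_b$ the class of $X^{5-b}Y^bG$ modulo lower degree. Combining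
`hr` and `hs` removes $E_0$; a further elimination leaves relations among $E_3,E_4,E_5$ whose
determinant is the quantity in `hD`. -/
theorem xAxis_elimination {A M : Type*} [CommRing A] [AddCommGroup M] [Module A M]
    (tf : ∀ d : A, d ≠ 0 → ∀ m : M, d • m = 0 → m = 0) {u v α β γ : A} (h3 : (3 : A) ≠ 0)
    (hγ : γ = 2 * u - 3 * v) (hα' : α = 108 * u ^ 2 - 9 * u - 3 * γ)
    (hβ : β = u + γ - 18 * u * γ) (hα : α ≠ 0) (hD : (6 * u * α + β) * β + α ^ 2 * γ ≠ 0)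
    {E : ℕ → M}
    (hr : ∀ b < 3, E (b + 1) - (2 : A) • E b = v • E (b + 3))
    (hs : ∀ b < 3, (3 : A) • E b - E (b + 1) = u • ((3 : A) • E (b + 2) - E (b + 3))) :
    ∀ b < 6, E b = 0 := by
  have r0 := hr 0 (by norm_num)
  have r1 := hr 1 (by norm_num)
  have r2 := hr 2 (by norm_num)
  have s0 := hs 0 (by norm_num)
  have s1 := hs 1 (by norm_num)
  have s2 := hs 2 (by norm_num)
  norm_num at r0 r1 r2 s0 s1 s2
  subst hγ
  have q0 : E 1 = (6 * u) • E 2 - (2 * u - 3 * v) • E 3 := by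
    linear_combination (norm := module) (3 : A) • r0 + (2 : A) • s0
  have q1 : E 2 = (6 * u) • E 3 - (2 * u - 3 * v) • E 4 := by
    linear_combination (norm := module) (3 : A) • r1 + (2 : A) • s1
  have q2 : E 3 = (6 * u) • E 4 - (2 * u - 3 * v) • E 5 := by
    linear_combination (norm := module) (3 : A) • r2 + (2 : A) • s2
  have l2 : α • E 4 + β • E 5 = 0 := by
    rw [hα', hβ]
    linear_combination (norm := module) s2 - (3 : A) • q1 - (18 * u - 1) • q2
  have l1 : α • E 3 + β • E 4 = 0 := by
    rw [hα', hβ]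
    linear_combination (norm := module) s1 - (3 : A) • q0 - (18 * u - 1) • q1
  have e5 : E 5 = 0 := by
    refine tf _ hD _ ?_
    linear_combination (norm := module) (6 * u * α + β) • l2 - α • l1 + (α ^ 2) • q2
  have e4 : E 4 = 0 := tf _ hα _ (by rw [e5] at l2; simpa using l2)
  have e3 : E 3 = 0 := by rw [q2, e4, e5]; simp
  have e2 : E 2 = 0 := by rw [q1, e3, e4]; simp
  have e1 : E 1 = 0 := by rw [q0, e2, e3]; simp
  have e0 : E 0 = 0 := tf _ h3 _ (by rw [e1, e2, e3] at s0; simpa using s0)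
  intro b hb
  interval_cases b <;> assumption

/-- The same scheme for five classes, with $v=yt$ and $w=t^3$; the quantity in `hD` is the
coefficient with which $E_4$ survives. -/
theorem yAxis_elimination {A M : Type*} [CommRing A] [AddCommGroup M] [Module A M]
    (tf : ∀ d : A, d ≠ 0 → ∀ m : M, d • m = 0 → m = 0) {v w a b : A} (h6 : (6 : A) ≠ 0)
    (ha' : a = -9 * v ^ 2 + 15 * v - 4) (hb : b = (3 * v - 2) * (1 - v) + 18 * w) (ha : a ≠ 0)
    (hD : (a * (5 - 3 * v) - 6 * b) * b - a ^ 2 * (1 - v) ≠ 0) {E : ℕ → M}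
    (hr : ∀ k < 2, E (k + 1) - (2 : A) • E k = w • E (k + 3))
    (hs : ∀ k < 3, (6 : A) • E k - (5 : A) • E (k + 1) + E (k + 2) =
      v • (E (k + 2) - (3 : A) • E (k + 1))) :
    ∀ k < 5, E k = 0 := by
  have r0 := hr 0 (by norm_num)
  have r1 := hr 1 (by norm_num)
  have s0 := hs 0 (by norm_num)
  have s1 := hs 1 (by norm_num)
  have s2 := hs 2 (by norm_num)
  norm_num at r0 r1 s0 s1 s2
  have l1 : a • E 3 - b • E 4 = 0 := by
    rw [ha', hb]
    linear_combination (norm := module) (18 : A) • r1 + (6 : A) • s1 - (3 * v - 2) • s2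
  have l0 : a • E 2 - b • E 3 = 0 := by
    rw [ha', hb]
    linear_combination (norm := module) (18 : A) • r0 + (6 : A) • s0 - (3 * v - 2) • s1
  have e4 : E 4 = 0 := by
    refine tf _ hD _ ?_
    linear_combination (norm := module) (6 * a) • l0 - (a ^ 2) • s2 - (a * (5 - 3 * v) - 6 * b) • l1
  have e3 : E 3 = 0 := tf _ ha _ (by rw [e4] at l1; simpa using l1)
  have e2 : E 2 = 0 := tf _ ha _ (by rw [e3] at l0; simpa using l0)
  have e1 : E 1 = 0 := tf _ h6 _ (by rw [e2, e3] at s1; simpa using s1)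
  have e0 : E 0 = 0 := tf _ h6 _ (by rw [e1, e2] at s0; simpa using s0)
  intro b hb
  interval_cases b <;> assumption

end WalkSeriesDFinite

/-! ### D-finiteness of the two axis series, and the functional equation -/

section TandemDFinite

theorem ne_zero_of_eval {σ : Type*} {p : MvPolynomial σ ℚ} (x : σ → ℚ)
    (h : MvPolynomial.eval x p ≠ 0) : p ≠ 0 := by
  rintro rfl
  exact h (map_zero _)

/-- The sum `m + i`, for the walks of length `3 m + 2 i` that end at `(i, 0)`. -/
def xAxisParam (e : Fin 3 →₀ ℕ) : ℚ := ((e 2 : ℚ) + e 0) / 3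

/-- The length of a walk. -/
def lengthParam (e : Fin 3 →₀ ℕ) : ℚ := e 2

theorem xAxisSeries_rec_t (e : Fin 3 →₀ ℕ) :
    ((lengthParam + (-2 : ℚ) • xAxisParam) *
      ((xAxisParam + (1 : ℚ) • 1) * (xAxisParam + (2 : ℚ) • 1))) e * xAxisSeries e =
    if expo 0 0 3 ≤ e then
      ((lengthParam + (1 : ℚ) • 1) * ((lengthParam + (2 : ℚ) • 1) * (lengthParam + (3 : ℚ) • 1)))
        (e - expo 0 0 3) * xAxisSeries (e - expo 0 0 3) else 0 := by
  revert e
  rw [forall_expo]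
  intro i j n
  simp only [expo_le_expo, expo_sub_expo, xAxisSeries_expo, Pi.mul_apply, Pi.add_apply,
    Pi.smul_apply, Pi.one_apply, smul_eq_mul, mul_one, xAxisParam, lengthParam, expo_zero,
    expo_two, Nat.sub_zero, Nat.zero_le, true_and, neg_mul, ← sub_eq_add_neg]
  split_ifs with h h' h'
  · simpa only [if_pos h'] using walkCount_xAxis_rec_t i n
  · simpa only [if_neg h'] using walkCount_xAxis_rec_t i n
  · simp
  · simp

theorem xAxisSeries_rec_x (e : Fin 3 →₀ ℕ) :
    (((3 : ℚ) • xAxisParam + (-1 : ℚ) • lengthParam) *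
      ((xAxisParam + (1 : ℚ) • 1) * (xAxisParam + (2 : ℚ) • 1))) e * xAxisSeries e =
    if expo 1 0 2 ≤ e then
      (((3 : ℚ) • xAxisParam + (-1 : ℚ) • lengthParam + (3 : ℚ) • 1) *
        ((lengthParam + (1 : ℚ) • 1) * (lengthParam + (2 : ℚ) • 1)))
        (e - expo 1 0 2) * xAxisSeries (e - expo 1 0 2) else 0 := by
  revert e
  rw [forall_expo]
  intro i j n
  simp only [expo_le_expo, expo_sub_expo, xAxisSeries_expo, Pi.mul_apply, Pi.add_apply,
    Pi.smul_apply, Pi.one_apply, smul_eq_mul, mul_one, xAxisParam, lengthParam, expo_zero,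
    expo_two, Nat.sub_zero, Nat.zero_le, true_and, neg_mul, one_mul, ← sub_eq_add_neg]
  split_ifs with h h' h'
  · simpa only [if_pos h'] using walkCount_xAxis_rec_x i n
  · simpa only [if_neg h'] using walkCount_xAxis_rec_x i n
  · simp
  · simp

/-- Degree 5 makes the system square: two recurrences of degree 3, each multiplied by the three
monomials of degree 2, give six relations for the six monomials of degree 5. -/
theorem termwise_xAxis_mem {a b : ℕ} (hab : a + b = 5) :
    termwise (xAxisParam ^ a * lengthParam ^ b) xAxisSeries ∈
      satSpan (termwiseSet xAxisParam lengthParam xAxisSeries 5) := by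
  set X := xAxisParam
  set Y := lengthParam
  set S := satSpan (termwiseSet X Y xAxisSeries 5)
  let E : ℕ → MvPowerSeries (Fin 3) ℚ ⧸ S :=
    fun b => S.mkQ (termwise (X ^ (5 - b) * Y ^ b) xAxisSeries)
  have hX := sameLead_X X Y
  have hY := sameLead_Y X Y
  have hr : ∀ b < 3, E (b + 1) - (2 : MvPolynomial (Fin 3) ℚ) • E b =
      (MvPolynomial.monomial (expo 0 0 3) 1 : MvPolynomial (Fin 3) ℚ) • E (b + 3) := by
    intro b hb
    have h := mkQ_termwise_eq (X := X) (Y := Y) (α := 1) (β := 3) xAxisSeries_rec_t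
      (by intro e; simp only [X, xAxisParam, Finsupp.add_apply, expo_zero, expo_two]; push_cast; ring)
      (by intro e; simp only [Y, lengthParam, Finsupp.add_apply, expo_two]; push_cast; ring)
      ((hY.add (hX.smul (-2))).mul ((hX.add_const 1).mul (hX.add_const 2)))
      ((hY.add_const 1).mul ((hY.add_const 2).mul (hY.add_const 3))) (2 - b) b
      (N := 5) (by omega)
    have e1 : X ^ (2 - b) * Y ^ b * ((Y + (-2 : ℚ) • X) * (X * X)) =
        X ^ (5 - (b + 1)) * Y ^ (b + 1) + (-2 : ℚ) • (X ^ (5 - b) * Y ^ b) := by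
      rw [show 5 - (b + 1) = 2 - b + 2 by omega, show 5 - b = 2 - b + 3 by omega]
      funext e
      simp only [Pi.mul_apply, Pi.add_apply, Pi.pow_apply, Pi.smul_apply, smul_eq_mul]
      ring
    have e2 : X ^ (2 - b) * Y ^ b * (Y * (Y * Y)) = X ^ (5 - (b + 3)) * Y ^ (b + 3) := by
      rw [show 5 - (b + 3) = 2 - b by omega]
      ring
    rw [e1, e2, mkQ_termwise_add_smul, map_neg, map_ofNat, neg_smul, ← sub_eq_add_neg] at h
    exact h
  have hs : ∀ b < 3, (3 : MvPolynomial (Fin 3) ℚ) • E b - E (b + 1) =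
      (MvPolynomial.monomial (expo 1 0 2) 1 : MvPolynomial (Fin 3) ℚ) •
        ((3 : MvPolynomial (Fin 3) ℚ) • E (b + 2) - E (b + 3)) := by
    intro b hb
    have h := mkQ_termwise_eq (X := X) (Y := Y) (α := 1) (β := 2) xAxisSeries_rec_x
      (by intro e; simp only [X, xAxisParam, Finsupp.add_apply, expo_zero, expo_two]; push_cast; ring)
      (by intro e; simp only [Y, lengthParam, Finsupp.add_apply, expo_two]; push_cast; ring)
      (((hX.smul 3).add (hY.smul (-1))).mul ((hX.add_const 1).mul (hX.add_const 2)))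
      ((((hX.smul 3).add (hY.smul (-1))).add_const 3).mul
        ((hY.add_const 1).mul (hY.add_const 2))) (2 - b) b (N := 5) (by omega)
    have e1 : X ^ (2 - b) * Y ^ b * (((3 : ℚ) • X + (-1 : ℚ) • Y) * (X * X)) =
        0 + (3 : ℚ) • (X ^ (5 - b) * Y ^ b) + (-1 : ℚ) • (X ^ (5 - (b + 1)) * Y ^ (b + 1)) := by
      rw [show 5 - (b + 1) = 2 - b + 2 by omega, show 5 - b = 2 - b + 3 by omega]
      funext e
      simp only [Pi.mul_apply, Pi.add_apply, Pi.pow_apply, Pi.smul_apply, smul_eq_mul,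
        Pi.zero_apply]
      ring
    have e2 : X ^ (2 - b) * Y ^ b * (((3 : ℚ) • X + (-1 : ℚ) • Y) * (Y * Y)) =
        0 + (3 : ℚ) • (X ^ (5 - (b + 2)) * Y ^ (b + 2)) +
          (-1 : ℚ) • (X ^ (5 - (b + 3)) * Y ^ (b + 3)) := by
      rw [show 5 - (b + 3) = 2 - b by omega, show 5 - (b + 2) = 2 - b + 1 by omega]
      funext e
      simp only [Pi.mul_apply, Pi.add_apply, Pi.pow_apply, Pi.smul_apply, smul_eq_mul,
        Pi.zero_apply]
      ring
    rw [e1, e2] at h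
    simp only [mkQ_termwise_add_smul, termwise_zero] at h
    simp only [map_zero, zero_add, map_neg, map_one, map_ofNat, neg_smul, one_smul,
      ← sub_eq_add_neg] at h
    exact h
  -- At $x=y=t=1$, $\alpha$ is 102 and the determinant is 936, so neither is the zero polynomial.
  have key := xAxis_elimination eq_zero_of_smul_mkQ
    (ne_zero_of_eval (fun _ => 1) (by simp)) rfl rfl rfl
    (ne_zero_of_eval (fun _ => 1) (by simp [MvPolynomial.eval_monomial]; norm_num))
    (ne_zero_of_eval (fun _ => 1) (by simp [MvPolynomial.eval_monomial]; norm_num)) hr hs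
    b (by omega)
  obtain rfl : a = 5 - b := by omega
  exact (Submodule.Quotient.mk_eq_zero S).mp key

theorem derivClosed_xAxis : DerivClosed (termwiseSet xAxisParam lengthParam xAxisSeries 5) := by
  refine derivClosed_termwiseSet ?_ fun a b => termwise_xAxis_mem
  intro i
  fin_cases i
  · exact ⟨3, -1, fun e _ => by simp only [xAxisParam, lengthParam, Fin.zero_eta]; ring⟩
  · refine ⟨0, 0, fun e he => ?_⟩
    have : e 1 = 0 := by
      by_contra h
      exact he (if_neg h)
    simp [this]
  · exact ⟨0, 1, fun e _ => by simp [lengthParam]⟩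

/-- The number `m`, for the walks of length `3 m + j` that end at `(0, j)`. -/
def yAxisParam (e : Fin 3 →₀ ℕ) : ℚ := ((e 2 : ℚ) - e 1) / 3

theorem yAxisSeries_rec_t (e : Fin 3 →₀ ℕ) :
    (yAxisParam * ((yAxisParam + (1 : ℚ) • 1) *
      (lengthParam + (-2 : ℚ) • yAxisParam + (2 : ℚ) • 1))) e * yAxisSeries e =
    if expo 0 0 3 ≤ e then
      ((lengthParam + (1 : ℚ) • 1) * ((lengthParam + (2 : ℚ) • 1) * (lengthParam + (3 : ℚ) • 1)))
        (e - expo 0 0 3) * yAxisSeries (e - expo 0 0 3) else 0 := by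
  revert e
  rw [forall_expo]
  intro i j n
  simp only [expo_le_expo, expo_sub_expo, yAxisSeries_expo, Pi.mul_apply, Pi.add_apply,
    Pi.smul_apply, Pi.one_apply, smul_eq_mul, mul_one, yAxisParam, lengthParam, expo_one,
    expo_two, Nat.sub_zero, Nat.zero_le, true_and, neg_mul, ← sub_eq_add_neg]
  split_ifs with h h' h'
  · simpa only [if_pos h'] using walkCount_yAxis_rec_t j n
  · simpa only [if_neg h'] using walkCount_yAxis_rec_t j n
  · simp
  · simp

theorem yAxisSeries_rec_y (e : Fin 3 →₀ ℕ) :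
    ((lengthParam + (-3 : ℚ) • yAxisParam) *
      (lengthParam + (-2 : ℚ) • yAxisParam + (2 : ℚ) • 1)) e * yAxisSeries e =
    if expo 0 1 1 ≤ e then
      ((lengthParam + (-3 : ℚ) • yAxisParam + (3 : ℚ) • 1) * (lengthParam + (1 : ℚ) • 1))
        (e - expo 0 1 1) * yAxisSeries (e - expo 0 1 1) else 0 := by
  revert e
  rw [forall_expo]
  intro i j n
  simp only [expo_le_expo, expo_sub_expo, yAxisSeries_expo, Pi.mul_apply, Pi.add_apply,
    Pi.smul_apply, Pi.one_apply, smul_eq_mul, mul_one, yAxisParam, lengthParam, expo_one,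
    expo_two, Nat.sub_zero, Nat.zero_le, true_and, neg_mul, ← sub_eq_add_neg]
  split_ifs with h h' h'
  · simpa only [if_pos h'] using walkCount_yAxis_rec_y j n
  · simpa only [if_neg h'] using walkCount_yAxis_rec_y j n
  · simp
  · simp

/-- Degree 4 suffices: the recurrence of degree 3 gives two relations and that of degree 2 gives
three, for five monomials. -/
theorem termwise_yAxis_mem {a b : ℕ} (hab : a + b = 4) :
    termwise (yAxisParam ^ a * lengthParam ^ b) yAxisSeries ∈
      satSpan (termwiseSet yAxisParam lengthParam yAxisSeries 4) := by
  set X := yAxisParam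
  set Y := lengthParam
  set S := satSpan (termwiseSet X Y yAxisSeries 4)
  let E : ℕ → MvPowerSeries (Fin 3) ℚ ⧸ S :=
    fun b => S.mkQ (termwise (X ^ (4 - b) * Y ^ b) yAxisSeries)
  have hX := sameLead_X X Y
  have hY := sameLead_Y X Y
  have hr : ∀ b < 2, E (b + 1) - (2 : MvPolynomial (Fin 3) ℚ) • E b =
      (MvPolynomial.monomial (expo 0 0 3) 1 : MvPolynomial (Fin 3) ℚ) • E (b + 3) := by
    intro b hb
    have h := mkQ_termwise_eq (X := X) (Y := Y) (α := 1) (β := 3) yAxisSeries_rec_t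
      (by intro e; simp only [X, yAxisParam, Finsupp.add_apply, expo_one, expo_two]; push_cast; ring)
      (by intro e; simp only [Y, lengthParam, Finsupp.add_apply, expo_two]; push_cast; ring)
      (hX.mul ((hX.add_const 1).mul ((hY.add (hX.smul (-2))).add_const 2)))
      ((hY.add_const 1).mul ((hY.add_const 2).mul (hY.add_const 3))) (1 - b) b
      (N := 4) (by omega)
    have e1 : X ^ (1 - b) * Y ^ b * (X * (X * (Y + (-2 : ℚ) • X))) =
        X ^ (4 - (b + 1)) * Y ^ (b + 1) + (-2 : ℚ) • (X ^ (4 - b) * Y ^ b) := by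
      rw [show 4 - (b + 1) = 1 - b + 2 by omega, show 4 - b = 1 - b + 3 by omega]
      funext e
      simp only [Pi.mul_apply, Pi.add_apply, Pi.pow_apply, Pi.smul_apply, smul_eq_mul]
      ring
    have e2 : X ^ (1 - b) * Y ^ b * (Y * (Y * Y)) = X ^ (4 - (b + 3)) * Y ^ (b + 3) := by
      rw [show 4 - (b + 3) = 1 - b by omega]
      ring
    rw [e1, e2, mkQ_termwise_add_smul, map_neg, map_ofNat, neg_smul, ← sub_eq_add_neg] at h
    exact h
  have hs : ∀ b < 3, (6 : MvPolynomial (Fin 3) ℚ) • E b -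
      (5 : MvPolynomial (Fin 3) ℚ) • E (b + 1) + E (b + 2) =
      (MvPolynomial.monomial (expo 0 1 1) 1 : MvPolynomial (Fin 3) ℚ) •
        (E (b + 2) - (3 : MvPolynomial (Fin 3) ℚ) • E (b + 1)) := by
    intro b hb
    have h := mkQ_termwise_eq (X := X) (Y := Y) (α := 0) (β := 1) yAxisSeries_rec_y
      (by intro e; simp only [X, yAxisParam, Finsupp.add_apply, expo_one, expo_two]; push_cast; ring)
      (by intro e; simp only [Y, lengthParam, Finsupp.add_apply, expo_two]; push_cast; ring)
      ((hY.add (hX.smul (-3))).mul ((hY.add (hX.smul (-2))).add_const 2))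
      (((hY.add (hX.smul (-3))).add_const 3).mul (hY.add_const 1)) (2 - b) b (N := 4) (by omega)
    have e1 : X ^ (2 - b) * Y ^ b * ((Y + (-3 : ℚ) • X) * (Y + (-2 : ℚ) • X)) =
        0 + (6 : ℚ) • (X ^ (4 - b) * Y ^ b) + (-5 : ℚ) • (X ^ (4 - (b + 1)) * Y ^ (b + 1)) +
          (1 : ℚ) • (X ^ (4 - (b + 2)) * Y ^ (b + 2)) := by
      rw [show 4 - (b + 1) = 2 - b + 1 by omega, show 4 - b = 2 - b + 2 by omega,
        show 4 - (b + 2) = 2 - b by omega]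
      funext e
      simp only [Pi.mul_apply, Pi.add_apply, Pi.pow_apply, Pi.smul_apply, smul_eq_mul,
        Pi.zero_apply]
      ring
    have e2 : X ^ (2 - b) * Y ^ b * ((Y + (-3 : ℚ) • X) * Y) =
        X ^ (4 - (b + 2)) * Y ^ (b + 2) + (-3 : ℚ) • (X ^ (4 - (b + 1)) * Y ^ (b + 1)) := by
      rw [show 4 - (b + 1) = 2 - b + 1 by omega, show 4 - (b + 2) = 2 - b by omega]
      funext e
      simp only [Pi.mul_apply, Pi.add_apply, Pi.pow_apply, Pi.smul_apply, smul_eq_mul]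
      ring
    rw [e1, e2] at h
    simp only [mkQ_termwise_add_smul, termwise_zero] at h
    simp only [map_zero, zero_add, map_neg, map_one, map_ofNat, neg_smul, one_smul,
      ← sub_eq_add_neg] at h
    exact h
  -- At $(x,y,t)=(1,0,1)$ one has $v=0$, $w=1$, so $a=-4$ and the determinant is $-1872$.
  have key := yAxis_elimination eq_zero_of_smul_mkQ
    (ne_zero_of_eval (fun _ => 1) (by simp)) rfl rfl
    (ne_zero_of_eval ![1, 0, 1] (by simp [MvPolynomial.eval_monomial, Finsupp.prod_fintype, Fin.prod_univ_three,
      expo_zero, expo_one, expo_two]))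
    (ne_zero_of_eval ![1, 0, 1] (by simp [MvPolynomial.eval_monomial, Finsupp.prod_fintype, Fin.prod_univ_three,
      expo_zero, expo_one, expo_two]; norm_num)) hr hs
    b (by omega)
  obtain rfl : a = 4 - b := by omega
  exact (Submodule.Quotient.mk_eq_zero S).mp key

theorem derivClosed_yAxis : DerivClosed (termwiseSet yAxisParam lengthParam yAxisSeries 4) := by
  refine derivClosed_termwiseSet ?_ fun a b => termwise_yAxis_mem
  intro i
  fin_cases i
  · refine ⟨0, 0, fun e he => ?_⟩
    have : e 0 = 0 := by
      by_contra h
      exact he (if_neg h)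
    simp [this]
  · exact ⟨-3, 1, fun e _ => by simp only [yAxisParam, lengthParam, Fin.mk_one]; ring⟩
  · exact ⟨0, 1, fun e _ => by simp [lengthParam]⟩

/-! #### The functional equation -/

theorem coeff_monomial_expo_mul (a b c i j n : ℕ) (F : MvPowerSeries (Fin 3) ℚ) :
    MvPowerSeries.coeff (expo i j n) (MvPowerSeries.monomial (expo a b c) 1 * F) =
      if a ≤ i ∧ b ≤ j ∧ c ≤ n then MvPowerSeries.coeff (expo (i - a) (j - b) (n - c)) F
      else 0 := by
  classical
  rw [MvPowerSeries.coeff_monomial_mul, expo_sub_expo, one_mul]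
  simp only [expo_le_expo]

theorem coeff_xAxisSeries (i j n : ℕ) : MvPowerSeries.coeff (expo i j n) xAxisSeries =
    if j = 0 then (walkCount tandemSteps i 0 n : ℚ) else 0 := rfl

theorem coeff_yAxisSeries (i j n : ℕ) : MvPowerSeries.coeff (expo i j n) yAxisSeries =
    if i = 0 then (walkCount tandemSteps 0 j n : ℚ) else 0 := rfl

/-- The functional equation for `Q(x, y; t)`, obtained by removing the last step. -/
theorem walkSeries_functional_equation :
    MvPowerSeries.monomial (expo 1 1 0) 1 * toThreeVar (walkSeries tandemSteps) =
      MvPowerSeries.monomial (expo 1 1 0) (1 : ℚ) +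
      MvPowerSeries.monomial (expo 0 1 1) 1 * (toThreeVar (walkSeries tandemSteps) - yAxisSeries) +
      MvPowerSeries.monomial (expo 1 2 1) 1 * toThreeVar (walkSeries tandemSteps) +
      MvPowerSeries.monomial (expo 2 0 1) 1 *
        (toThreeVar (walkSeries tandemSteps) - xAxisSeries) := by
  classical
  ext e
  revert e
  rw [forall_expo]
  intro i j n
  simp only [map_add, map_sub, coeff_monomial_expo_mul, MvPowerSeries.coeff_monomial, expo_inj,
    coeff_toThreeVar_walkSeries, coeff_xAxisSeries, coeff_yAxisSeries]
  -- For $i=0$ or $j=0$ the subtracted axis series cancels the walks to which W or SE cannot be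
  -- appended; elsewhere the identity is `walkCount_succ`.
  rcases i with _ | i
  · simp
  rcases j with _ | j
  · simp
  rcases n with _ | n
  · simp [walkCount_zero]
  rcases i with _ | i <;> rcases j with _ | j <;> simp [walkCount_succ]
  ring

/-- The kernel $xy-ty-txy^2-tx^2$ is a nonzero polynomial, so the functional equation can be solved
for $Q$. -/
theorem toThreeVar_walkSeries_mem : toThreeVar (walkSeries tandemSteps) ∈
    satSpan (termwiseSet xAxisParam lengthParam xAxisSeries 5 ∪
      termwiseSet yAxisParam lengthParam yAxisSeries 4 ∪ {1}) := by
  set S := satSpan (termwiseSet xAxisParam lengthParam xAxisSeries 5 ∪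
      termwiseSet yAxisParam lengthParam yAxisSeries 4 ∪ {1})
  let m : (Fin 3 →₀ ℕ) → MvPolynomial (Fin 3) ℚ := fun e => MvPolynomial.monomial e 1
  have h1 : (1 : MvPowerSeries (Fin 3) ℚ) ∈ S := subset_satSpan _ (Or.inr rfl)
  have hx : xAxisSeries ∈ S := subset_satSpan _
    (Or.inl (Or.inl ⟨0, 0, by norm_num, by funext e; simp [termwise]⟩))
  have hy : yAxisSeries ∈ S := subset_satSpan _
    (Or.inl (Or.inr ⟨0, 0, by norm_num, by funext e; simp [termwise]⟩))
  refine mem_satSpan_of_smul_mem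
    (d := m (expo 1 1 0) - m (expo 0 1 1) - m (expo 1 2 1) - m (expo 2 0 1))
    (ne_zero_of_eval ![1, 1, 0] ?_) ?_
  · simp [m, MvPolynomial.eval_monomial, Finsupp.prod_fintype, Fin.prod_univ_three,
      expo_zero, expo_one, expo_two]
  · have e : (m (expo 1 1 0) - m (expo 0 1 1) - m (expo 1 2 1) - m (expo 2 0 1)) •
        toThreeVar (walkSeries tandemSteps) =
        m (expo 1 1 0) • (1 : MvPowerSeries (Fin 3) ℚ) - m (expo 0 1 1) • yAxisSeries -
          m (expo 2 0 1) • xAxisSeries := by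
      simp only [m, sub_smul, mvPolynomial_smul_eq, MvPolynomial.coe_monomial]
      linear_combination walkSeries_functional_equation
    rw [e]
    exact sub_mem (sub_mem (Submodule.smul_mem _ _ h1) (Submodule.smul_mem _ _ hy))
      (Submodule.smul_mem _ _ hx)

theorem isDFinite_walkSeries : IsDFinite (toThreeVar (walkSeries tandemSteps)) :=
  isDFinite_of_mem_satSpan
    (((termwiseSet_finite _ _ _ _).union (termwiseSet_finite _ _ _ _)).union
      (Set.finite_singleton _))
    ((derivClosed_xAxis.union derivClosed_yAxis).union derivClosed_one) toThreeVar_walkSeries_mem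

end TandemDFinite

theorem mainTheorem3 :
    -- `Q(x,y;t)` is the non-negative part of the rational series, and is D-finite
    specialize (monoXY 1 0) (monoXY 0 1) (walkSeries tandemSteps) = nonnegPart tandemRational ∧
    IsDFinite (toThreeVar (walkSeries tandemSteps)) ∧
    -- the number of walks of length `3m+2i+j` ending at `(i,j)`
    (∀ i j m : ℕ, (walkCount tandemSteps i j (3 * m + 2 * i + j) : ℚ) =
      ((i + 1) * (j + 1) * (i + j + 2) * (3 * m + 2 * i + j).factorial : ℚ) /
        (m.factorial * (m + i + 1).factorial * (m + i + j + 2).factorial)) ∧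
    -- walks ending at the origin
    (∀ m : ℕ, (walkCount tandemSteps 0 0 (3 * m) : ℚ) =
      (2 * (3 * m).factorial : ℚ) /
        (m.factorial * (m + 1).factorial * (m + 2).factorial)) ∧
    Asymptotics.IsEquivalent Filter.atTop
      (fun m : ℕ => (walkCount tandemSteps 0 0 (3 * m) : ℝ))
      (fun m : ℕ => √3 * ((3 : ℝ) ^ (3 * m) / (Real.pi * (m : ℝ) ^ 4))) ∧
    -- `Q(0,0;t)` and `Q(x,y;t)` are transcendental
    Transcendental (Polynomial ℚ) (specialize (0 : ℚ) 0 (walkSeries tandemSteps)) ∧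
    Transcendental (MvPolynomial (Fin 3) ℚ) (toThreeVar (walkSeries tandemSteps)) ∧
    -- `Q(x,1/x;t)` is algebraic of degree 2 over `ℚ(x)(t)`, and its expression
    IsAlgebraic (RatFunc (RatFunc ℚ)) (toLaurent
      (specialize (RatFunc.X : RatFunc ℚ) (RatFunc.X)⁻¹ (walkSeries tandemSteps))) ∧
    (minpoly (RatFunc (RatFunc ℚ)) (toLaurent
      (specialize (RatFunc.X : RatFunc ℚ) (RatFunc.X)⁻¹ (walkSeries tandemSteps)))).natDegree
        = 2 ∧
    (∃ s : PowerSeries (RatFunc ℚ),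
      IsSeriesSqrt s (1 - 2 * PowerSeries.C (RatFunc.X)⁻¹ * PowerSeries.X
        + PowerSeries.X ^ 2 * PowerSeries.C (RatFunc.X)⁻¹ ^ 2
        - 4 * PowerSeries.X ^ 2 * PowerSeries.C RatFunc.X) ∧
      toLaurent (specialize (RatFunc.X : RatFunc ℚ) (RatFunc.X)⁻¹ (walkSeries tandemSteps)) =
        toLaurent (1 - PowerSeries.X * PowerSeries.C (RatFunc.X)⁻¹ - s) /
          toLaurent (2 * PowerSeries.C RatFunc.X * PowerSeries.X ^ 2)) ∧
    -- the total number of `n`-step walks is the `n`th Motzkin number, and `Q(1,1;t)`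
    (∀ n : ℕ, (quadrantWalks tandemSteps n).card = motzkinNumber n) ∧
    (∃ s : PowerSeries ℚ,
      IsSeriesSqrt s ((1 + PowerSeries.X) * (1 - 3 * PowerSeries.X)) ∧
      toLaurent (specialize (1 : ℚ) 1 (walkSeries tandemSteps)) =
        toLaurent (1 - PowerSeries.X - s) / toLaurent (2 * PowerSeries.X ^ 2)) ∧
    specialize (1 : ℚ) 1 (walkSeries tandemSteps) =
      PowerSeries.mk (fun n : ℕ => ∑ k ∈ Finset.range (n / 2 + 1),
        (1 / ((k : ℚ) + 1)) * (n.choose (2 * k) : ℚ) * ((2 * k).choose k : ℚ)) := by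
  refine ⟨specialize_walkSeries_eq_nonnegPart, isDFinite_walkSeries, walkCount_eq,
    walkCount_origin, walkCount_origin_isEquivalent, transcendental_excursions,
    transcendental_walkSeries, specialize_ratFunc_inv_degree.1, specialize_ratFunc_inv_degree.2,
    specialize_inv_sqrt RatFunc.X_ne_zero, card_quadrantWalks_eq_motzkinNumber,
    specialize_one_one_sqrt, specialize_one_one_eq_mk⟩
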